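/- Let $R$ be either a noetherian (commutative) local ring with maximal ideal $\mathfrak m$, or a (commutative) standard graded algebra over a field $k$, i.e. $R=\bigoplus_{i\ge 0}R_i$ with $R_0=k$, $\dim_k R_1<\infty$ and $R$ generated by $R_1$ as a $k$-algebra, with graded maximal ideal $\mathfrak m=\bigoplus_{i>0}R_i$. In the graded case all modules are $\mathbb Z$-graded, and all maps are homogeneous of degree $0$. For a finitely generated $R$-module $M$ with minimal free resolution $(F,\partial)$ (minimal graded free resolution in the graded case), filter $F$ by the subcomplexes $\mathcal G^nF$ with $(\mathcal G^nF)_i=\mathfrak m^{n-i}F_i$, where $\mathfrak m^j=R$ for $j\le 0$, and let $\operatorname{lin}^RF=\bigoplus_n\mathcal G^nF/\mathcal G^{n+1}F$ be the associated graded complex. The linearity defect of $M$ is $\sup\{i: H_i(\operatorname{lin}^RF)\ne 0\}$ (and $0$ if $M=0$); $M$ is called a Koszul module if its linearity defect is $0$. Write $\operatorname{pd}_R M$ for the projective dimension, and, in the graded case, $\operatorname{reg}_R M=\sup\{j-i: \operatorname{Tor}_i^R(k,M)_j\neq 0\}$ for the Castelnuovo–Mumford regularity. Both may be infinite. (1)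 Let $0\to M'\to P'\to N'\to 0$ be a short exact sequence of non-zero finitely generated $R$-modules such that $M'$ is a Koszul module and $M'\cap \mathfrak mP'=\mathfrak mM'$ (here $M'$ is identified with its image in $P'$). Then $$\operatorname{pd}_R P'=\max\{\operatorname{pd}_R M',\operatorname{pd}_R N'\},$$ and, in the graded case, also $$\operatorname{reg}_R P'=\max\{\operatorname{reg}_R M',\operatorname{reg}_R N'\}.$$ (2) Let $0\to M\to P\to N\to 0$ be a short exact sequence of non-zero finitely generated $R$-modules such that $P$ is a Koszul module and $M\subseteq \mathfrak mP$ (here $M$ is identified with its image in $P$). Then $$\operatorname{pd}_R N=\max\{\operatorname{pd}_R M+1,\operatorname{pd}_R P\},$$ and, in the graded case, also $$\operatorname{reg}_R N=\max\{\operatorname{reg}_R M-1,\operatorname{reg}_R P\}.$$ -/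

import Mathlib

open scoped TensorProduct

universe u v w

/-- The `i`-th cycles of a chain complex `⋯ ⟶ C 2 ⟶ C 1 ⟶ C 0 ⟶ 0` with differentials
`d i : C (i + 1) → C i` (the differential leaving `C 0` is zero). -/
def cyclesOf {R : Type u} [CommRing R] {C : ℕ → Type v} [∀ i, AddCommGroup (C i)]
    [∀ i, Module R (C i)] (d : ∀ i, C (i + 1) →ₗ[R] C i) : ∀ i, Submodule R (C i)
  | 0 => ⊤
  | i + 1 => LinearMap.ker (d i)

/-- The `i`-th homology module, cycles modulo boundaries, of a chain complex
`⋯ ⟶ C 2 ⟶ C 1 ⟶ C 0 ⟶ 0`. -/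
abbrev homologyOf {R : Type u} [CommRing R] {C : ℕ → Type v} [∀ i, AddCommGroup (C i)]
    [∀ i, Module R (C i)] (d : ∀ i, C (i + 1) →ₗ[R] C i) (i : ℕ) : Type v :=
  ↥(cyclesOf d i) ⧸ (LinearMap.range (d i)).submoduleOf (cyclesOf d i)

/-- A resolution of the `R`-module `M` by free modules of finite rank; the module in homological
degree `i` is the free module `ι i → R` on the finite set `ι i`. -/
structure FreeRes (R : Type u) [CommRing R] (M : Type v) [AddCommGroup M] [Module R M] where
  ι : ℕ → Type
  finite_index : ∀ i, Finite (ι i)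
  d : ∀ i, (ι (i + 1) → R) →ₗ[R] (ι i → R)
  aug : (ι 0 → R) →ₗ[R] M
  exact_succ : ∀ i, Function.Exact (d (i + 1)) (d i)
  exact_zero : Function.Exact (d 0) aug
  aug_surjective : Function.Surjective aug

namespace FreeRes

variable {R : Type u} [CommRing R] {M : Type v} [AddCommGroup M] [Module R M]

/-- The resolution is minimal with respect to the ideal `I` (in practice the maximal ideal of a
local ring, or the graded maximal ideal): each differential maps `F (i + 1)` into `I F i`. -/
def IsMinimal (F : FreeRes R M) (I : Ideal R) : Prop :=
  ∀ i, LinearMap.range (F.d i) ≤ I • (⊤ : Submodule R (F.ι i → R))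

/-- The filtration `(𝒢ⁿ F)_i = Iⁿ⁻ⁱ F_i`, where `Iʲ = R` for `j ≤ 0` (this is what truncated
subtraction gives). -/
def filt (F : FreeRes R M) (I : Ideal R) (n i : ℕ) : Submodule R (F.ι i → R) :=
  I ^ (n - i) • (⊤ : Submodule R (F.ι i → R))

theorem d_mem_filt (F : FreeRes R M) {I : Ideal R} (hF : F.IsMinimal I) (n i : ℕ) :
    ∀ x ∈ F.filt I n (i + 1), F.d i x ∈ F.filt I n i := by
  intro x hx
  unfold filt at hx ⊢
  rcases Nat.lt_or_ge i n with h | h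
  · have h1 : n - i = (n - (i + 1)) + 1 := by omega
    have h2 : F.d i x ∈ (I ^ (n - (i + 1)) • (⊤ : Submodule R (F.ι (i + 1) → R))).map (F.d i) :=
      Submodule.mem_map_of_mem hx
    rw [Submodule.map_smul'', Submodule.map_top] at h2
    rw [h1, pow_succ, Submodule.mul_smul]
    exact Submodule.smul_mono le_rfl (hF i) h2
  · rw [Nat.sub_eq_zero_of_le h, pow_zero, Ideal.one_eq_top, Submodule.top_smul]
    exact Submodule.mem_top

/-- The component `(𝒢ⁿ F)_i / (𝒢ⁿ⁺¹ F)_i` of the linear part of `F`. -/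
abbrev linPart (F : FreeRes R M) (I : Ideal R) (n i : ℕ) : Type u :=
  ↥(F.filt I n i) ⧸ (F.filt I (n + 1) i).submoduleOf (F.filt I n i)

/-- The differential of the linear part, induced by the differential of `F`. -/
def linPartD (F : FreeRes R M) {I : Ideal R} (hF : F.IsMinimal I) (n i : ℕ) :
    F.linPart I n (i + 1) →ₗ[R] F.linPart I n i :=
  Submodule.mapQ _ _ ((F.d i).restrict (F.d_mem_filt hF n i))
    (fun x hx => F.d_mem_filt hF (n + 1) i x.1 hx)

/-- `H_i (lin F) ≠ 0`, where `lin F` is the direct sum over `n` of the complexes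
`(𝒢ⁿ F) / (𝒢ⁿ⁺¹ F)`. -/
def LinHomologyNeZero (F : FreeRes R M) {I : Ideal R} (hF : F.IsMinimal I) (i : ℕ) : Prop :=
  ∃ n : ℕ, Nontrivial (homologyOf (R := R) (C := fun l => F.linPart I n l) (fun l => F.linPartD hF n l) i)

/-- The differential of the complex `R/I ⊗ F`. -/
def residueD (F : FreeRes R M) (I : Ideal R) (i : ℕ) :
    (R ⧸ I) ⊗[R] (F.ι (i + 1) → R) →ₗ[R] (R ⧸ I) ⊗[R] (F.ι i → R) :=
  (F.d i).lTensor (R ⧸ I)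

/-- `Tor_i (R/I, M)`, computed from the free resolution `F` of `M`. -/
abbrev tor (F : FreeRes R M) (I : Ideal R) (i : ℕ) : Type u :=
  homologyOf (C := fun l => (R ⧸ I) ⊗[R] (F.ι l → R)) (fun l => F.residueD I l) i

end FreeRes

/-- The linearity defect `sup {i : H_i (lin F) ≠ 0}` of a finitely generated module `M` over a
noetherian local ring, where `F` is the minimal free resolution of `M`. (The minimal free
resolution is unique up to isomorphism, so it does not matter which one is used. The supremum of
the empty set in `ℕ∞` is `0`, the conventional value for the zero module.) -/
noncomputable def linDefect (R : Type u) [CommRing R] [IsLocalRing R] (M : Type v)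
    [AddCommGroup M] [Module R M] : ℕ∞ :=
  sSup {l | ∃ (F : FreeRes R M) (hF : F.IsMinimal (IsLocalRing.maximalIdeal R)) (i : ℕ),
    F.LinHomologyNeZero hF i ∧ l = (i : ℕ∞)}

/-- Koszul modules over a noetherian local ring. -/
def IsKoszulModule (R : Type u) [CommRing R] [IsLocalRing R] (M : Type v)
    [AddCommGroup M] [Module R M] : Prop :=
  linDefect R M = 0

/-- `R = ⨁ 𝒜 i` is a standard graded `k`-algebra: it is nonzero and nonnegatively graded,
`𝒜 0 = k`, and it is generated as a `k`-algebra by the finite-dimensional space `𝒜 1`. -/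
structure IsStandardGraded {k : Type w} [Field k] {R : Type u} [CommRing R] [Algebra k R]
    (𝒜 : ℤ → Submodule k R) [GradedAlgebra 𝒜] : Prop where
  nontrivial : Nontrivial R
  neg : ∀ i < 0, 𝒜 i = ⊥
  zero : 𝒜 0 = LinearMap.range (Algebra.linearMap k R)
  finite_one : Module.Finite k (𝒜 1)
  adjoin_one : Algebra.adjoin k (𝒜 1 : Set R) = ⊤

section Graded

variable {k : Type w} [Field k] {R : Type u} [CommRing R] [Algebra k R]

/-- The graded maximal ideal, generated by the homogeneous elements of positive degree. -/
def gradedMaxIdeal (𝒜 : ℤ → Submodule k R) : Ideal R :=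
  Ideal.span {x | ∃ i : ℤ, 0 < i ∧ x ∈ 𝒜 i}

/-- The component of degree `j` of the graded free module `⨁ e, R(-a e)`, whose basis element
with index `e` has degree `a e`. -/
def freePiece (𝒜 : ℤ → Submodule k R) {ι : Type} (a : ι → ℤ) (j : ℤ) : AddSubgroup (ι → R) where
  carrier := {x | ∀ e, x e ∈ 𝒜 (j - a e)}
  zero_mem' := fun _ => Submodule.zero_mem _
  add_mem' := fun hx hy e => Submodule.add_mem _ (hx e) (hy e)
  neg_mem' := fun hx e => Submodule.neg_mem _ (hx e)

variable {M : Type v} [AddCommGroup M] [Module R M]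

/-- A graded free resolution of the graded module `M = ⨁ ℳ j`: the free modules carry gradings
for which all maps are homogeneous of degree `0`. -/
structure GradedFreeRes (𝒜 : ℤ → Submodule k R) (ℳ : ℤ → AddSubgroup M) extends
    FreeRes R M where
  deg : ∀ i, ι i → ℤ
  d_mem : ∀ (i : ℕ) (j : ℤ), ∀ x ∈ freePiece 𝒜 (deg (i + 1)) j, d i x ∈ freePiece 𝒜 (deg i) j
  aug_mem : ∀ j : ℤ, ∀ x ∈ freePiece 𝒜 (deg 0) j, aug x ∈ ℳ j

/-- The linearity defect of a finitely generated graded module over a standard graded algebra,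
computed from the minimal graded free resolution. -/
noncomputable def gradedLinDefect (𝒜 : ℤ → Submodule k R) (ℳ : ℤ → AddSubgroup M) : ℕ∞ :=
  sSup {l | ∃ (F : GradedFreeRes 𝒜 ℳ) (hF : F.toFreeRes.IsMinimal (gradedMaxIdeal 𝒜)) (i : ℕ),
    F.toFreeRes.LinHomologyNeZero hF i ∧ l = (i : ℕ∞)}

/-- Koszul modules over a standard graded algebra. -/
def IsGradedKoszulModule (𝒜 : ℤ → Submodule k R) (ℳ : ℤ → AddSubgroup M) : Prop :=
  gradedLinDefect 𝒜 ℳ = 0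

/-- The component of degree `j` of `Tor_i (k, M)`, where `k = R/𝔪`, computed from the graded free
resolution `F` of `M`: the classes of cycles that lie in the component `(k ⊗ F_i)_j`, the image
of `(F_i)_j`. -/
def GradedFreeRes.torPiece {𝒜 : ℤ → Submodule k R} {ℳ : ℤ → AddSubgroup M}
    (F : GradedFreeRes 𝒜 ℳ) (i : ℕ) (j : ℤ) :
    AddSubgroup (F.toFreeRes.tor (gradedMaxIdeal 𝒜) i) :=
  (((freePiece 𝒜 (F.deg i) j).map
    (TensorProduct.mk R (R ⧸ gradedMaxIdeal 𝒜) (F.ι i → R) 1).toAddMonoidHom).comap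
    (Submodule.subtype _).toAddMonoidHom).map (Submodule.mkQ _).toAddMonoidHom

/-- The Castelnuovo-Mumford regularity `sup {j - i : Tor_i (k, M)_j ≠ 0}` of a finitely generated
graded module over a standard graded algebra, as an extended real number. (`Tor` does not depend
on the graded free resolution that it is computed from.) -/
noncomputable def regularity (𝒜 : ℤ → Submodule k R) (ℳ : ℤ → AddSubgroup M) : EReal :=
  sSup {r | ∃ (F : GradedFreeRes 𝒜 ℳ) (i : ℕ) (j : ℤ),
    F.torPiece i j ≠ ⊥ ∧ r = (((j - (i : ℤ) : ℤ) : ℝ) : EReal)}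

end Graded

/-- The projective dimension of a module. -/
noncomputable abbrev projDim (R : Type u) [CommRing R] (M : Type u) [AddCommGroup M]
    [Module R M] : WithBot ℕ∞ :=
  CategoryTheory.projectiveDimension (ModuleCat.of R M)

/-!
Call `0 → M → P → N → 0` pure if `M ∩ 𝔪P = 𝔪M`. Then a minimal cover `F₀ → M` and a lift to `P` of a
minimal cover `H₀ → N` form a minimal cover `F₀ ⊕ H₀ → P`, which gives an exact sequence of syzygies
`0 → ΩM → ΩP → ΩN → 0`. As `ΩP ⊆ 𝔪(F₀ ⊕ H₀)`, we have `ΩM ∩ 𝔪ΩP ⊆ ΩM ∩ 𝔪²F₀`, and if `M` is Koszul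
then the acyclicity of the linear part of its resolution yields `ΩM ∩ 𝔪²F₀ = 𝔪ΩM`. So the sequence
of syzygies is again pure, and by induction `Tor_i (k, P)_j ≠ 0` if and only if `Tor_i (k, M)_j ≠ 0`
or `Tor_i (k, N)_j ≠ 0`.

If `M ⊆ 𝔪P`, then a minimal cover `F₀ → P` is also a minimal cover of `N`, and the exact sequence
`0 → ΩP → ΩN → M → 0` is pure when `P` is Koszul, because `ΩN ⊆ 𝔪F₀`.
-/

theorem exists_comp_eq_of_range_le {R E F M : Type*} [CommRing R] [AddCommGroup E] [Module R E]
    [Module.Projective R E] [AddCommGroup F] [Module R F] [AddCommGroup M] [Module R M]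
    {d : F →ₗ[R] M} {h : E →ₗ[R] M} (hle : LinearMap.range h ≤ LinearMap.range d) :
    ∃ f : E →ₗ[R] F, d ∘ₗ f = h := by
  obtain ⟨f, hf⟩ := Module.projective_lifting_property d.rangeRestrict
    (h.codRestrict _ fun x => hle ⟨x, rfl⟩) d.surjective_rangeRestrict
  exact ⟨f, LinearMap.ext fun x => congrArg Subtype.val (LinearMap.congr_fun hf x)⟩

/-- A `ℤ`-grading of an additive group, given by the projections onto the homogeneous components.
Encoding a grading by its projections lets the grading concentrated in degree `0` (for a local
ring) and the one of a graded algebra be treated alike. -/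
structure IntGrading (M : Type v) [AddCommGroup M] where
  proj : ℤ → M →+ M
  proj_proj : ∀ i j x, proj i (proj j x) = if i = j then proj j x else 0
  exists_sum_proj : ∀ x, ∃ s : Finset ℤ, ∑ j ∈ s, proj j x = x

namespace IntGrading

variable {M : Type v} [AddCommGroup M] (g : IntGrading M)

/-- The homogeneous component of degree `j`, as the fixed points of the projection onto it. -/
def piece (j : ℤ) : AddSubgroup M :=
  (g.proj j).eqLocus (AddMonoidHom.id M)

variable {g}

theorem mem_piece {j : ℤ} {x : M} : x ∈ g.piece j ↔ g.proj j x = x :=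
  Iff.rfl

theorem proj_mem (j : ℤ) (x : M) : g.proj j x ∈ g.piece j := by
  rw [mem_piece, g.proj_proj, if_pos rfl]

theorem proj_eq_ite {i j : ℤ} {x : M} (hx : x ∈ g.piece j) :
    g.proj i x = if i = j then x else 0 := by
  rw [← mem_piece.1 hx, g.proj_proj]

theorem exists_sum_proj_of_superset (x : M) :
    ∃ s : Finset ℤ, ∀ t, s ⊆ t → ∑ j ∈ t, g.proj j x = x := by
  obtain ⟨s, hs⟩ := g.exists_sum_proj x
  refine ⟨s, fun t hst => (Finset.sum_subset hst fun i _ hi => ?_).symm.trans hs⟩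
  rw [← hs, map_sum]
  exact Finset.sum_eq_zero fun j hj => by
    rw [g.proj_proj, if_neg (ne_of_mem_of_not_mem hj hi).symm]

theorem induction_on {p : M → Prop} (x : M) (zero : p 0) (add : ∀ x y, p x → p y → p (x + y))
    (homogeneous : ∀ j, ∀ x ∈ g.piece j, p x) : p x := by
  obtain ⟨s, hs⟩ := g.exists_sum_proj x
  rw [← hs]
  exact Finset.sum_induction _ p add zero fun j _ => homogeneous j _ (proj_mem j x)

end IntGrading

/-- A map of graded groups that is homogeneous of degree `0`. -/
def IsGradedHom {M : Type*} {N : Type*} [AddCommGroup M] [AddCommGroup N] (gM : IntGrading M)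
    (gN : IntGrading N) (f : M → N) : Prop :=
  ∀ j x, f (gM.proj j x) = gN.proj j (f x)

namespace IsGradedHom

variable {M N P : Type*} [AddCommGroup M] [AddCommGroup N] [AddCommGroup P]
  {gM : IntGrading M} {gN : IntGrading N} {gP : IntGrading P}

theorem map_mem {f : M → N} (hf : IsGradedHom gM gN f) {j : ℤ} {x : M} (hx : x ∈ gM.piece j) :
    f x ∈ gN.piece j := by
  rw [IntGrading.mem_piece, ← hf, IntGrading.mem_piece.1 hx]

theorem of_map_mem {F : Type*} [FunLike F M N] [AddMonoidHomClass F M N] {f : F}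
    (hf : ∀ j, ∀ x ∈ gM.piece j, f x ∈ gN.piece j) : IsGradedHom gM gN f := by
  intro i x
  induction x using gM.induction_on with
  | zero => simp only [map_zero]
  | add x y hx hy => simp only [map_add, hx, hy]
  | homogeneous j x hx =>
    rw [IntGrading.proj_eq_ite hx, IntGrading.proj_eq_ite (hf j x hx), apply_ite f, map_zero]

theorem comp {f : M → N} {h : N → P} (hh : IsGradedHom gN gP h) (hf : IsGradedHom gM gN f) :
    IsGradedHom gM gP (h ∘ f) := fun j x => by
  rw [Function.comp_apply, hf, hh, Function.comp_apply]

end IsGradedHom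

/-- A `ℤ`-grading of a commutative ring. -/
structure RingGrading (R : Type u) [CommRing R] extends IntGrading R where
  mul_mem : ∀ {i j r s}, r ∈ toIntGrading.piece i → s ∈ toIntGrading.piece j →
    r * s ∈ toIntGrading.piece (i + j)
  one_mem : 1 ∈ toIntGrading.piece 0

/-- A `ℤ`-grading of a module over a graded ring. -/
structure ModuleGrading {R : Type u} [CommRing R] (gR : RingGrading R) (M : Type v)
    [AddCommGroup M] [Module R M] extends IntGrading M where
  smul_mem : ∀ {i j r x}, r ∈ gR.piece i → x ∈ toIntGrading.piece j →
    r • x ∈ toIntGrading.piece (i + j)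

namespace ModuleGrading

variable {R : Type u} [CommRing R] {gR : RingGrading R} {M : Type v} [AddCommGroup M] [Module R M]
  {N : Type*} [AddCommGroup N] [Module R N] {ι : Type} [Finite ι]

theorem proj_smul_of_mem (gM : ModuleGrading gR M) {i j : ℤ} {x : M} (hx : x ∈ gM.piece j)
    (r : R) : gM.proj i (r • x) = gR.proj (i - j) r • x := by
  induction r using gR.induction_on with
  | zero => simp only [zero_smul, map_zero]
  | add r s hr hs => simp only [add_smul, map_add, hr, hs]
  | homogeneous l r hr =>
    rw [IntGrading.proj_eq_ite (gM.smul_mem hr hx), IntGrading.proj_eq_ite hr, ite_smul, zero_smul]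
    exact if_congr (by omega) rfl rfl

/-- The graded free module `⨁ e, R(-a e)`, whose basis element with index `e` has degree `a e`. -/
def free (gR : RingGrading R) (a : ι → ℤ) : ModuleGrading gR (ι → R) where
  proj j :=
    { toFun := fun x e => gR.proj (j - a e) (x e)
      map_zero' := funext fun e => map_zero _
      map_add' := fun x y => funext fun e => map_add _ _ _ }
  proj_proj i j x := by
    ext e
    simp only [AddMonoidHom.coe_mk, ZeroHom.coe_mk, gR.proj_proj, sub_left_inj]
    split_ifs <;> rfl
  exists_sum_proj x := by
    have := Fintype.ofFinite ι
    choose s hs using fun e => gR.exists_sum_proj_of_superset (x e)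
    refine ⟨Finset.univ.biUnion fun e => (s e).image (· + a e), funext fun e => ?_⟩
    rw [Finset.sum_apply]
    refine Eq.trans ?_ (hs e ((Finset.univ.biUnion fun e => (s e).image (· + a e)).map
      (Equiv.subRight (a e)).toEmbedding) fun j hj => ?_)
    · rw [Finset.sum_map]; rfl
    · simp only [Finset.mem_map_equiv, Finset.mem_biUnion, Finset.mem_univ, true_and,
        Finset.mem_image]
      exact ⟨e, j, hj, rfl⟩
  smul_mem {i j r x} hr hx := funext fun e => by
    have h := gR.mul_mem hr (congrFun hx e : x e ∈ gR.piece (j - a e))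
    rwa [← add_sub_assoc] at h

instance : CoeOut (ModuleGrading gR M) (IntGrading M) :=
  ⟨toIntGrading⟩

variable {gM : ModuleGrading gR M} {gN : ModuleGrading gR N} {a : ι → ℤ}

/-- The grading induced on the kernel of a graded homomorphism. -/
def _root_.IsGradedHom.kerGrading {f : M →ₗ[R] N} (hf : IsGradedHom gM gN f) :
    ModuleGrading gR (LinearMap.ker f) where
  proj j := ((gM.proj j).comp (LinearMap.ker f).subtype.toAddMonoidHom).codRestrict
    (LinearMap.ker f) fun x => by
      rw [LinearMap.mem_ker]
      exact (hf j x).trans (by rw [LinearMap.mem_ker.1 x.2, map_zero])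
  proj_proj i j x := Subtype.ext <| (gM.proj_proj i j x).trans (by split_ifs <;> rfl)
  exists_sum_proj x := by
    obtain ⟨s, hs⟩ := gM.exists_sum_proj x
    exact ⟨s, Subtype.ext (by rw [AddSubmonoidClass.coe_finsetSum]; exact hs)⟩
  smul_mem hr hx := Subtype.ext (gM.smul_mem hr (congrArg Subtype.val hx))

theorem isGradedHom_subtype_ker {f : M →ₗ[R] N} (hf : IsGradedHom gM gN f) :
    IsGradedHom (hf.kerGrading) gM (LinearMap.ker f).subtype :=
  fun _ _ => rfl

theorem basisFun_mem_piece_free (a : ι → ℤ) (e : ι) :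
    Pi.basisFun R ι e ∈ (free gR a).piece (a e) := by
  classical
  rw [IntGrading.mem_piece]
  ext e'
  change gR.proj (a e - a e') (Pi.basisFun R ι e e') = Pi.basisFun R ι e e'
  rw [Pi.basisFun_apply]
  obtain rfl | h := eq_or_ne e' e
  · rw [Pi.single_eq_same, sub_self]
    exact gR.one_mem
  · rw [Pi.single_eq_of_ne h, map_zero]

theorem isGradedHom_free_iff {f : (ι → R) →ₗ[R] M} :
    IsGradedHom (free gR a) gM f ↔ ∀ e, f (Pi.basisFun R ι e) ∈ gM.piece (a e) := by
  have := Fintype.ofFinite ι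
  refine ⟨fun hf e => hf.map_mem (basisFun_mem_piece_free a e), fun hf j x => ?_⟩
  have hsum (y : ι → R) : f y = ∑ e, y e • f (Pi.basisFun R ι e) := by
    conv_lhs => rw [← (Pi.basisFun R ι).sum_repr y, map_sum]
    simp only [map_smul, Pi.basisFun_repr]
  rw [hsum x, map_sum, hsum]
  exact Finset.sum_congr rfl fun e _ => (gM.proj_smul_of_mem (hf e) (x e)).symm

theorem exists_isGradedHom_comp_eq {F : Type*} [AddCommGroup F] [Module R F]
    {gF : ModuleGrading gR F} {d : F →ₗ[R] M} {h : (ι → R) →ₗ[R] M} (hd : IsGradedHom gF gM d)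
    (hh : IsGradedHom (free gR a) gM h) (hle : LinearMap.range h ≤ LinearMap.range d) :
    ∃ f : (ι → R) →ₗ[R] F, IsGradedHom (free gR a) gF f ∧ d ∘ₗ f = h := by
  obtain ⟨f, rfl⟩ := exists_comp_eq_of_range_le hle
  refine ⟨(Pi.basisFun R ι).constr ℕ fun e => gF.proj (a e) (f (Pi.basisFun R ι e)),
    isGradedHom_free_iff.2 fun e => ?_, (Pi.basisFun R ι).ext fun e => ?_⟩
  · rw [Module.Basis.constr_basis]
    exact IntGrading.proj_mem _ _
  · rw [LinearMap.comp_apply, Module.Basis.constr_basis, hd]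
    exact IntGrading.mem_piece.1 (isGradedHom_free_iff.1 hh e)

end ModuleGrading

theorem mem_smul_top_pi_iff {R : Type*} [CommRing R] {ι : Type*} [Finite ι] {I : Ideal R}
    {x : ι → R} : x ∈ I • (⊤ : Submodule R (ι → R)) ↔ ∀ e, x e ∈ I := by
  have := Fintype.ofFinite ι
  refine ⟨fun hx e => ?_, fun hx => ?_⟩
  · have hmap := Submodule.mem_map_of_mem (f := LinearMap.proj (R := R) (φ := fun _ => R) e) hx
    rw [Submodule.map_smul''] at hmap
    exact Ideal.mul_le_left hmap
  · rw [← (Pi.basisFun R ι).sum_repr x]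
    exact Submodule.sum_mem _ fun e _ => Submodule.smul_mem_smul (hx e) Submodule.mem_top

theorem comap_smul_top_of_ker_le {R E M : Type*} [CommRing R] [AddCommGroup E] [Module R E]
    [AddCommGroup M] [Module R M] {I : Ideal R} {f : E →ₗ[R] M} (hf : Function.Surjective f)
    (hker : LinearMap.ker f ≤ I • ⊤) :
    (I • (⊤ : Submodule R M)).comap f = I • ⊤ := by
  rw [← LinearMap.range_eq_top.2 hf, ← Submodule.map_top, ← Submodule.map_smul'',
    Submodule.comap_map_eq, sup_eq_left.2 hker]

section MinimalCover

variable {R : Type u} [CommRing R] {gR : RingGrading R} {I : Ideal R} {M : Type v}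
  [AddCommGroup M] [Module R M] {gM : ModuleGrading gR M}

/-- `I` plays the role of the maximal ideal of the graded ring `R`: it is proper and an element
outside of `I` has an invertible component of degree `0`. This covers the maximal ideal of a local
ring, graded in degree `0`, and the graded maximal ideal of a standard graded algebra. -/
structure IsGradedLocal (gR : RingGrading R) (I : Ideal R) : Prop where
  ne_top : I ≠ ⊤
  isUnit_proj_zero : ∀ r ∉ I, IsUnit (gR.proj 0 r)

/-- A minimal graded free cover `⨁ e, R(-a e) → M`: the first step of a minimal graded free
resolution of `M`. -/
structure IsMinimalCover (gM : ModuleGrading gR M) (I : Ideal R) {ι : Type} [Finite ι] (a : ι → ℤ)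
    (β : (ι → R) →ₗ[R] M) : Prop where
  graded : IsGradedHom (ModuleGrading.free gR a) gM β
  surjective : Function.Surjective β
  ker_le : LinearMap.ker β ≤ I • ⊤

/-- `M` is generated by `n` homogeneous elements. -/
def HasHomogeneousGenerators (gM : ModuleGrading gR M) (n : ℕ) : Prop :=
  ∃ (a : Fin n → ℤ) (β : (Fin n → R) →ₗ[R] M),
    IsGradedHom (ModuleGrading.free gR a) gM β ∧ Function.Surjective β

theorem hasHomogeneousGenerators_of_span_eq_top {n : ℕ} {a : Fin n → ℤ} {m : Fin n → M}
    (hm : ∀ e, m e ∈ gM.piece (a e)) (hspan : Submodule.span R (Set.range m) = ⊤) :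
    HasHomogeneousGenerators gM n := by
  refine ⟨a, (Pi.basisFun R (Fin n)).constr ℕ m, ModuleGrading.isGradedHom_free_iff.2 fun e => ?_,
    ?_⟩
  · rw [Module.Basis.constr_basis]
    exact hm e
  · rw [← LinearMap.range_eq_top, Module.Basis.constr_range, hspan]

theorem exists_hasHomogeneousGenerators [Module.Finite R M] (gM : ModuleGrading gR M) :
    ∃ n, HasHomogeneousGenerators gM n := by
  have hspan : Submodule.span R {x | ∃ j, x ∈ gM.piece j} = ⊤ :=
    Submodule.eq_top_iff'.2 fun x => gM.induction_on x (zero_mem _)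
      (fun _ _ => add_mem) fun j x hx => Submodule.subset_span ⟨j, hx⟩
  obtain ⟨s, hs, hs_span⟩ := (Submodule.fg_span_iff_fg_span_finset_subset _).1
    (hspan ▸ Module.Finite.fg_top : (Submodule.span R {x | ∃ j, x ∈ gM.piece j}).FG)
  choose a ha using fun x : s => hs x.2
  refine ⟨s.card, hasHomogeneousGenerators_of_span_eq_top (a := a ∘ s.equivFin.symm)
    (m := Subtype.val ∘ s.equivFin.symm) (fun e => ha _) ?_⟩
  rw [EquivLike.range_comp, Subtype.range_coe_subtype]
  exact hs_span.symm.trans hspan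

theorem hasHomogeneousGenerators_of_isUnit_coeff {n : ℕ} {a : Fin (n + 1) → ℤ}
    {β : (Fin (n + 1) → R) →ₗ[R] M} (hβ : IsGradedHom (ModuleGrading.free gR a) gM β)
    (hsurj : Function.Surjective β) {x : Fin (n + 1) → R} (hx : β x = 0) {e : Fin (n + 1)}
    (hxe : IsUnit (x e)) : HasHomogeneousGenerators gM n := by
  set m := fun i => β (Pi.basisFun R _ i) with hm
  have hβ_sum (y : Fin (n + 1) → R) :
      β y = y e • m e + ∑ i, y (e.succAbove i) • m (e.succAbove i) := by
    conv_lhs => rw [← (Pi.basisFun R _).sum_repr y, map_sum]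
    simp only [map_smul, Pi.basisFun_repr, Fin.sum_univ_succAbove _ e, hm]
  have hsum_mem (y : Fin (n + 1) → R) : ∑ i, y (e.succAbove i) • m (e.succAbove i) ∈
      Submodule.span R (Set.range (m ∘ e.succAbove)) :=
    sum_mem fun i _ => Submodule.smul_mem _ _ (Submodule.subset_span ⟨i, rfl⟩)
  have hme : m e ∈ Submodule.span R (Set.range (m ∘ e.succAbove)) := by
    rw [← Submodule.smul_mem_iff_of_isUnit _ hxe,
      eq_neg_of_add_eq_zero_left ((hβ_sum x).symm.trans hx)]
    exact neg_mem (hsum_mem x)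
  refine hasHomogeneousGenerators_of_span_eq_top (a := a ∘ e.succAbove) (m := m ∘ e.succAbove)
    (fun i => ModuleGrading.isGradedHom_free_iff.1 hβ _) ?_
  refine Submodule.eq_top_iff'.2 fun z => ?_
  obtain ⟨y, rfl⟩ := hsurj z
  rw [hβ_sum]
  exact add_mem (Submodule.smul_mem _ _ hme) (hsum_mem y)

theorem exists_isMinimalCover [Module.Finite R M] (hI : IsGradedLocal gR I)
    (gM : ModuleGrading gR M) :
    ∃ (n : ℕ) (a : Fin n → ℤ) (β : (Fin n → R) →ₗ[R] M), IsMinimalCover gM I a β := by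
  classical
  have hgen := exists_hasHomogeneousGenerators gM
  obtain ⟨a, β, hβ, hsurj⟩ := Nat.find_spec hgen
  refine ⟨Nat.find hgen, a, β, hβ, hsurj, fun x hx => mem_smul_top_pi_iff.2 fun e => ?_⟩
  by_contra hxe
  have hx' : β ((ModuleGrading.free gR a).proj (a e) x) = 0 := by
    rw [hβ, LinearMap.mem_ker.1 hx, map_zero]
  have hunit : IsUnit ((ModuleGrading.free gR a).proj (a e) x e) := by
    have h := hI.isUnit_proj_zero _ hxe
    rwa [← sub_self (a e)] at h
  obtain ⟨n, hn⟩ := Nat.exists_eq_succ_of_ne_zero (Fin.pos e).ne'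
  refine Nat.find_min hgen (m := n) (by omega) ?_
  generalize Nat.find hgen = N at *
  subst hn
  exact hasHomogeneousGenerators_of_isUnit_coeff hβ hsurj hx' hunit

namespace IsMinimalCover

variable {ι : Type} [Finite ι] {a : ι → ℤ} {β : (ι → R) →ₗ[R] M}

theorem apply_mem_smul_top_iff (hβ : IsMinimalCover gM I a β) {x : ι → R} :
    β x ∈ I • (⊤ : Submodule R M) ↔ x ∈ I • (⊤ : Submodule R (ι → R)) := by
  rw [← comap_smul_top_of_ker_le hβ.surjective hβ.ker_le, Submodule.mem_comap]

end IsMinimalCover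

theorem IsGradedLocal.subsingleton_of_smul_top_eq_top [Module.Finite R M]
    (hI : IsGradedLocal gR I) (gM : ModuleGrading gR M) (h : I • (⊤ : Submodule R M) = ⊤) :
    Subsingleton M := by
  obtain ⟨n, a, β, hβ⟩ := exists_isMinimalCover hI gM
  have hone : 1 ∈ I • (⊤ : Submodule R (Fin n → R)) :=
    hβ.apply_mem_smul_top_iff.1 (by rw [h]; exact Submodule.mem_top)
  have : IsEmpty (Fin n) :=
    ⟨fun e => hI.ne_top ((Ideal.eq_top_iff_one I).2 (mem_smul_top_pi_iff.1 hone e))⟩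
  exact hβ.surjective.subsingleton

end MinimalCover

section Comparison

theorem exists_seq_of_step {α : ℕ → Type*} {p : ∀ i, α i → Prop}
    {r : ∀ i, α i → α (i + 1) → Prop} {x₀ : α 0} (zero : p 0 x₀)
    (succ : ∀ i x, p i x → ∃ y, p (i + 1) y ∧ r i x y) :
    ∃ f : ∀ i, α i, f 0 = x₀ ∧ (∀ i, p i (f i)) ∧ ∀ i, r i (f i) (f (i + 1)) := by
  choose next hnext hr using fun i (x : {x // p i x}) => succ i x x.2
  let f : ∀ i, {x // p i x} := fun i => Nat.rec ⟨x₀, zero⟩ (fun i x => ⟨next i x, hnext i x⟩) i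
  have hf (i : ℕ) : r i (f i).1 (f (i + 1)).1 := hr i (f i)
  exact ⟨fun i => (f i).1, rfl, fun i => (f i).2, hf⟩

variable {R : Type u} [CommRing R] {M : Type v} [AddCommGroup M] [Module R M]

namespace FreeRes

instance (F : FreeRes R M) (i : ℕ) : Finite (F.ι i) :=
  F.finite_index i

/-- The elements of `F i` whose residue classes are the `i`-cycles of `R/I ⊗ F`. -/
def torCycles (F : FreeRes R M) (I : Ideal R) : ∀ i, Submodule R (F.ι i → R)
  | 0 => ⊤
  | i + 1 => (I • (⊤ : Submodule R (F.ι i → R))).comap (F.d i)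

/-- A morphism of resolutions lifting the identity of the resolved module. -/
structure IsComparison (F F' : FreeRes R M) (f : ∀ i, (F.ι i → R) →ₗ[R] (F'.ι i → R)) : Prop where
  comm : ∀ i x, F'.d i (f (i + 1) x) = f i (F.d i x)
  aug_comm : ∀ x, F'.aug (f 0 x) = F.aug x

variable {F F' F'' : FreeRes R M} {f : ∀ i, (F.ι i → R) →ₗ[R] (F'.ι i → R)} {I : Ideal R}

theorem IsComparison.map_mem_torCycles (hf : IsComparison F F' f) :
    ∀ {i} {z : F.ι i → R}, z ∈ F.torCycles I i → f i z ∈ F'.torCycles I i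
  | 0, _, _ => Submodule.mem_top
  | i + 1, z, hz => by
    rw [torCycles, Submodule.mem_comap, hf.comm]
    exact Submodule.smul_top_le_comap_smul_top I (f i) hz

theorem IsComparison.map_mem_range_sup (hf : IsComparison F F' f) {i : ℕ} {z : F.ι i → R}
    (hz : z ∈ LinearMap.range (F.d i) ⊔ I • ⊤) :
    f i z ∈ LinearMap.range (F'.d i) ⊔ I • ⊤ := by
  obtain ⟨_, ⟨x, rfl⟩, y, hy, rfl⟩ := Submodule.mem_sup.1 hz
  rw [map_add, ← hf.comm]
  exact Submodule.add_mem_sup (LinearMap.mem_range_self _ _)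
    (Submodule.smul_top_le_comap_smul_top I (f i) hy)

theorem exists_homotopy (F : FreeRes R M) {h : ∀ i, (F.ι i → R) →ₗ[R] (F.ι i → R)}
    (hcomm : ∀ i x, F.d i (h (i + 1) x) = h i (F.d i x)) (haug : ∀ x, F.aug (h 0 x) = 0) :
    ∃ s : ∀ i, (F.ι i → R) →ₗ[R] (F.ι (i + 1) → R),
      ∀ i, F.d (i + 1) ∘ₗ s (i + 1) = h (i + 1) - s i ∘ₗ F.d i := by
  obtain ⟨s₀, hs₀⟩ := exists_comp_eq_of_range_le (d := F.d 0) (h := h 0) <| by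
    rintro _ ⟨x, rfl⟩
    exact (F.exact_zero _).1 (haug x)
  obtain ⟨s, -, -, hs⟩ := exists_seq_of_step (x₀ := s₀)
    (p := fun i (s : (F.ι i → R) →ₗ[R] (F.ι (i + 1) → R)) =>
      ∀ x, F.d i (s (F.d i x)) = h i (F.d i x))
    (r := fun i s s' => F.d (i + 1) ∘ₗ s' = h (i + 1) - s ∘ₗ F.d i)
    (fun x => LinearMap.congr_fun hs₀ _) fun i s hs => by
      obtain ⟨s', hs'⟩ := exists_comp_eq_of_range_le (d := F.d (i + 1))
        (h := h (i + 1) - s ∘ₗ F.d i) <| by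
          rintro _ ⟨x, rfl⟩
          refine (F.exact_succ i _).1 ?_
          rw [LinearMap.sub_apply, map_sub, hcomm, LinearMap.comp_apply, hs, sub_self]
      refine ⟨s', fun x => ?_, hs'⟩
      rw [← LinearMap.comp_apply, hs', LinearMap.sub_apply, LinearMap.comp_apply,
        (F.exact_succ i).apply_apply_eq_zero, map_zero, sub_zero]
  exact ⟨s, hs⟩

theorem apply_mem_range_sup_of_mem_torCycles (F : FreeRes R M)
    {h : ∀ i, (F.ι i → R) →ₗ[R] (F.ι i → R)}
    (hcomm : ∀ i x, F.d i (h (i + 1) x) = h i (F.d i x)) (haug : ∀ x, F.aug (h 0 x) = 0) {i : ℕ}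
    {z : F.ι i → R} (hz : z ∈ F.torCycles I i) :
    h i z ∈ LinearMap.range (F.d i) ⊔ I • ⊤ := by
  cases i with
  | zero => exact Submodule.mem_sup_left ((F.exact_zero _).1 (haug z))
  | succ i =>
    obtain ⟨s, hs⟩ := F.exists_homotopy hcomm haug
    have hz_eq : h (i + 1) z = F.d (i + 1) (s (i + 1) z) + s i (F.d i z) :=
      sub_eq_iff_eq_add.1 (LinearMap.congr_fun (hs i) z).symm
    rw [hz_eq]
    exact Submodule.add_mem_sup (LinearMap.mem_range_self _ _)
      (Submodule.smul_top_le_comap_smul_top I (s i) hz)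

end FreeRes

variable {gR : RingGrading R} {gM : ModuleGrading gR M}

/-- A resolution of `M` by graded free modules of finite rank, all of whose maps are homogeneous
of degree `0`. -/
structure HomogRes (gM : ModuleGrading gR M) extends FreeRes R M where
  deg : ∀ i, ι i → ℤ
  d_graded : ∀ i, IsGradedHom (ModuleGrading.free gR (deg (i + 1))) (ModuleGrading.free gR (deg i))
    (d i)
  aug_graded : IsGradedHom (ModuleGrading.free gR (deg 0)) gM aug

namespace HomogRes

/-- `Tor_i (R/I, M)_j ≠ 0`, computed from the resolution `F` of `M`. -/
def TorNeZero (F : HomogRes gM) (I : Ideal R) (i : ℕ) (j : ℤ) : Prop :=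
  ∃ z ∈ (ModuleGrading.free gR (F.deg i)).piece j,
    z ∈ F.torCycles I i ∧ z ∉ LinearMap.range (F.d i) ⊔ I • ⊤

theorem exists_graded_comparison (F F' : HomogRes gM) :
    ∃ f : ∀ i, (F.ι i → R) →ₗ[R] (F'.ι i → R),
      (∀ i, IsGradedHom (ModuleGrading.free gR (F.deg i)) (ModuleGrading.free gR (F'.deg i)) (f i))
        ∧ FreeRes.IsComparison F.toFreeRes F'.toFreeRes f := by
  obtain ⟨f₀, hf₀, hcomp₀⟩ := ModuleGrading.exists_isGradedHom_comp_eq F'.aug_graded F.aug_graded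
    (by rw [LinearMap.range_eq_top.2 F'.aug_surjective]; exact le_top)
  have haug (x : F.ι 0 → R) : F'.aug (f₀ x) = F.aug x := LinearMap.congr_fun hcomp₀ x
  have hrange₀ : LinearMap.range (f₀ ∘ₗ F.d 0) ≤ LinearMap.range (F'.d 0) := by
    rintro _ ⟨x, rfl⟩
    exact (F'.exact_zero _).1 ((haug _).trans (F.exact_zero.apply_apply_eq_zero x))
  obtain ⟨f, rfl, hf, hcomm⟩ := exists_seq_of_step (x₀ := f₀)
    (p := fun i (f : (F.ι i → R) →ₗ[R] (F'.ι i → R)) =>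
      IsGradedHom (ModuleGrading.free gR (F.deg i)) (ModuleGrading.free gR (F'.deg i)) f ∧
        LinearMap.range (f ∘ₗ F.d i) ≤ LinearMap.range (F'.d i))
    (r := fun i f f' => F'.d i ∘ₗ f' = f ∘ₗ F.d i) ⟨hf₀, hrange₀⟩ fun i f ⟨hf, hle⟩ => by
      obtain ⟨f', hf', hcomm⟩ := ModuleGrading.exists_isGradedHom_comp_eq (h := f ∘ₗ F.d i)
        (F'.d_graded i) (hf.comp (F.d_graded i)) hle
      refine ⟨f', ⟨hf', ?_⟩, hcomm⟩
      rintro _ ⟨x, rfl⟩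
      refine (F'.exact_succ i _).1 ((LinearMap.congr_fun hcomm _).trans ?_)
      rw [LinearMap.comp_apply, (F.exact_succ i).apply_apply_eq_zero, map_zero]
  exact ⟨f, fun i => (hf i).1, fun i => LinearMap.congr_fun (hcomm i), haug⟩

theorem TorNeZero.of_res {F : HomogRes gM} {I : Ideal R} {i : ℕ} {j : ℤ} (h : F.TorNeZero I i j)
    (F' : HomogRes gM) : F'.TorNeZero I i j := by
  obtain ⟨z, hz, hz_cycle, hz_boundary⟩ := h
  obtain ⟨f, hf_graded, hf⟩ := exists_graded_comparison F F'
  obtain ⟨g, -, hg⟩ := exists_graded_comparison F' F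
  refine ⟨f i z, (hf_graded i).map_mem hz, hf.map_mem_torCycles hz_cycle, fun hfz => hz_boundary ?_⟩
  have hnull := F.apply_mem_range_sup_of_mem_torCycles (h := fun i => LinearMap.id - g i ∘ₗ f i)
    (fun i x => by simp only [LinearMap.sub_apply, LinearMap.id_apply, LinearMap.comp_apply,
      map_sub, hg.comm, hf.comm])
    (fun x => by simp only [LinearMap.sub_apply, LinearMap.id_apply, LinearMap.comp_apply,
      map_sub, hg.aug_comm, hf.aug_comm, sub_self]) hz_cycle
  exact sub_add_cancel z (g i (f i z)) ▸ add_mem hnull (hg.map_mem_range_sup hfz)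

theorem torNeZero_iff_exists_deg_eq {F : HomogRes gM} {I : Ideal R} (hI : IsGradedLocal gR I)
    (hF : F.IsMinimal I) {i : ℕ} {j : ℤ} : F.TorNeZero I i j ↔ ∃ e, F.deg i e = j := by
  have hcycles : F.torCycles I i = ⊤ := by
    cases i with
    | zero => rfl
    | succ i => exact eq_top_iff.2 fun x _ => hF i ⟨x, rfl⟩
  rw [TorNeZero, hcycles, sup_eq_right.2 (hF i)]
  simp only [Submodule.mem_top, true_and, mem_smul_top_pi_iff, not_forall]
  constructor
  · rintro ⟨z, hz, e, hze⟩
    refine ⟨e, ?_⟩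
    by_contra hne
    have hze_mem : z e ∈ gR.piece (j - F.deg i e) := congrFun hz e
    have hunit := hI.isUnit_proj_zero _ hze
    rw [IntGrading.proj_eq_ite hze_mem, if_neg (by omega)] at hunit
    exact hze (by rw [← one_mul (z e), ← isUnit_zero_iff.1 hunit, zero_mul]; exact I.zero_mem)
  · rintro ⟨e, rfl⟩
    refine ⟨_, ModuleGrading.basisFun_mem_piece_free _ e, e, ?_⟩
    classical
    rw [Pi.basisFun_apply, Pi.single_eq_same, ← Ideal.eq_top_iff_one]
    exact hI.ne_top

end HomogRes
end Comparison

section Tor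

variable {R : Type u} [CommRing R] {gR : RingGrading R} {I : Ideal R} {M : Type v}
  [AddCommGroup M] [Module R M] {gM : ModuleGrading gR M} {ι : Type} [Finite ι] {a : ι → ℤ}
  {β : (ι → R) →ₗ[R] M}

namespace HomogRes

/-- The first syzygy of the resolution `F`, resolved by the tail of `F`. -/
def syzygy (F : HomogRes gM) : HomogRes F.aug_graded.kerGrading where
  ι i := F.ι (i + 1)
  finite_index i := F.finite_index (i + 1)
  d i := F.d (i + 1)
  aug := (F.d 0).codRestrict (LinearMap.ker F.aug) F.exact_zero.apply_apply_eq_zero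
  exact_succ i := F.exact_succ (i + 1)
  exact_zero x := Subtype.ext_iff.trans (F.exact_succ 0 x)
  aug_surjective x := ((F.exact_zero _).1 x.2).imp fun _ hy => Subtype.ext hy
  deg i := F.deg (i + 1)
  d_graded i := F.d_graded (i + 1)
  aug_graded j x := Subtype.ext (F.d_graded 0 j x)

/-- The resolution of `M` obtained by splicing a graded free cover `β` of `M` with a resolution of
its kernel. -/
def cons (hβ : IsGradedHom (ModuleGrading.free gR a) gM β) (hsurj : Function.Surjective β)
    (E : HomogRes hβ.kerGrading) : HomogRes gM where
  ι
    | 0 => ι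
    | i + 1 => E.ι i
  finite_index
    | 0 => inferInstance
    | i + 1 => E.finite_index i
  d
    | 0 => (LinearMap.ker β).subtype ∘ₗ E.aug
    | i + 1 => E.d i
  aug := β
  exact_succ
    | 0 => fun x => Subtype.ext_iff.symm.trans (E.exact_zero x)
    | i + 1 => E.exact_succ i
  exact_zero x := ⟨fun hx => (E.aug_surjective ⟨x, hx⟩).imp fun _ hy => congrArg Subtype.val hy,
    fun ⟨y, hy⟩ => hy ▸ (E.aug y).2⟩
  aug_surjective := hsurj
  deg
    | 0 => a
    | i + 1 => E.deg i
  d_graded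
    | 0 => ModuleGrading.isGradedHom_subtype_ker hβ |>.comp E.aug_graded
    | i + 1 => E.d_graded i
  aug_graded := hβ

theorem isMinimal_cons (hβ : IsMinimalCover gM I a β) {E : HomogRes hβ.graded.kerGrading}
    (hE : E.IsMinimal I) : (cons hβ.graded hβ.surjective E).IsMinimal I
  | 0 => by
    rintro _ ⟨x, rfl⟩
    exact hβ.ker_le (E.aug x).2
  | i + 1 => hE i

theorem isMinimalCover_aug {F : HomogRes gM} (hF : F.IsMinimal I) :
    IsMinimalCover gM I (F.deg 0) F.aug :=
  ⟨F.aug_graded, F.aug_surjective, fun x hx => hF 0 ((F.exact_zero x).1 hx)⟩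

end HomogRes

/-- A stage in the construction of a minimal resolution: the graded free module constructed last,
and the submodule of it that remains to be resolved. -/
structure ResolutionStage (R : Type u) [CommRing R] where
  rank : ℕ
  deg : Fin rank → ℤ
  syzygies : Submodule R (Fin rank → R)

/-- The syzygies of the stage `S` form a graded submodule that lies in `I` times the free module. -/
def ResolutionStage.IsAdmissible (gR : RingGrading R) (I : Ideal R) (S : ResolutionStage R) :
    Prop :=
  S.syzygies ≤ I • ⊤ ∧ ∃ g : ModuleGrading gR S.syzygies,
    IsGradedHom g (ModuleGrading.free gR S.deg) S.syzygies.subtype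

theorem ResolutionStage.IsAdmissible.exists_next [IsNoetherianRing R] (hI : IsGradedLocal gR I)
    {S : ResolutionStage R} (hS : S.IsAdmissible gR I) :
    ∃ T : ResolutionStage R, T.IsAdmissible gR I ∧
      ∃ d : (Fin T.rank → R) →ₗ[R] (Fin S.rank → R),
        IsGradedHom (ModuleGrading.free gR T.deg) (ModuleGrading.free gR S.deg) d ∧
          LinearMap.range d = S.syzygies ∧ LinearMap.ker d = T.syzygies := by
  obtain ⟨-, g, hg⟩ := hS
  obtain ⟨n, a, γ, hγ⟩ := exists_isMinimalCover hI g
  refine ⟨⟨n, a, LinearMap.ker γ⟩, ⟨hγ.ker_le, _, ModuleGrading.isGradedHom_subtype_ker hγ.graded⟩,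
    S.syzygies.subtype ∘ₗ γ, hg.comp hγ.graded, ?_,
    LinearMap.ker_comp_of_ker_eq_bot _ S.syzygies.ker_subtype⟩
  rw [LinearMap.range_comp, LinearMap.range_eq_top.2 hγ.surjective, Submodule.map_top,
    Submodule.range_subtype]

theorem exists_isMinimal_homogRes [IsNoetherianRing R] [Module.Finite R M]
    (hI : IsGradedLocal gR I) (gM : ModuleGrading gR M) : ∃ F : HomogRes gM, F.IsMinimal I := by
  obtain ⟨n, a, β, hβ⟩ := exists_isMinimalCover hI gM
  obtain ⟨S, hS₀, hS, hstep⟩ := exists_seq_of_step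
    (α := fun _ => ResolutionStage R) (p := fun _ => ResolutionStage.IsAdmissible gR I)
    (x₀ := ⟨n, a, LinearMap.ker β⟩)
    ⟨hβ.ker_le, hβ.graded.kerGrading, ModuleGrading.isGradedHom_subtype_ker _⟩
    fun _ _ => ResolutionStage.IsAdmissible.exists_next hI
  choose d hd_graded hd_range hd_ker using hstep
  obtain ⟨α, hα⟩ : ∃ α : (Fin (S 0).rank → R) →ₗ[R] M,
      IsGradedHom (ModuleGrading.free gR (S 0).deg) gM α ∧ Function.Surjective α ∧
        LinearMap.ker α = (S 0).syzygies := by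
    rw [hS₀]
    exact ⟨β, hβ.graded, hβ.surjective, rfl⟩
  refine ⟨{ ι := fun i => Fin (S i).rank
            finite_index := fun i => inferInstance
            d := d
            aug := α
            exact_succ := fun i => LinearMap.exact_iff.2 ((hd_ker i).trans (hd_range (i + 1)).symm)
            exact_zero := LinearMap.exact_iff.2 (hα.2.2.trans (hd_range 0).symm)
            aug_surjective := hα.2.1
            deg := fun i => (S i).deg
            d_graded := hd_graded
            aug_graded := hα.1 }, fun i => (hd_range i).trans_le (hS i).1⟩

namespace ModuleGrading

/-- `Tor_i (R/I, M)_j ≠ 0`, where `Tor` is computed from an arbitrary graded free resolution. -/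
def TorNeZero (gM : ModuleGrading gR M) (I : Ideal R) (i : ℕ) (j : ℤ) : Prop :=
  ∃ F : HomogRes gM, F.TorNeZero I i j

theorem torNeZero_iff_exists_deg_eq (hI : IsGradedLocal gR I) {F : HomogRes gM}
    (hF : F.IsMinimal I) {i : ℕ} {j : ℤ} : gM.TorNeZero I i j ↔ ∃ e, F.deg i e = j := by
  rw [← HomogRes.torNeZero_iff_exists_deg_eq hI hF]
  exact ⟨fun ⟨_, h⟩ => h.of_res F, fun h => ⟨F, h⟩⟩

end ModuleGrading

namespace IsMinimalCover

variable [IsNoetherianRing R]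

theorem torNeZero_zero_iff (hI : IsGradedLocal gR I) (hβ : IsMinimalCover gM I a β) {j : ℤ} :
    gM.TorNeZero I 0 j ↔ ∃ e, a e = j := by
  obtain ⟨E, hE⟩ := exists_isMinimal_homogRes hI hβ.graded.kerGrading
  exact ModuleGrading.torNeZero_iff_exists_deg_eq hI (HomogRes.isMinimal_cons hβ hE)

theorem torNeZero_succ_iff (hI : IsGradedLocal gR I) (hβ : IsMinimalCover gM I a β) {i : ℕ}
    {j : ℤ} : gM.TorNeZero I (i + 1) j ↔ hβ.graded.kerGrading.TorNeZero I i j := by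
  obtain ⟨E, hE⟩ := exists_isMinimal_homogRes hI hβ.graded.kerGrading
  rw [ModuleGrading.torNeZero_iff_exists_deg_eq hI (HomogRes.isMinimal_cons hβ hE),
    ModuleGrading.torNeZero_iff_exists_deg_eq hI hE]
  rfl

end IsMinimalCover
end Tor

section Horseshoe

variable {R : Type u} [CommRing R] {gR : RingGrading R} {I : Ideal R} {M P N : Type*}
  [AddCommGroup M] [AddCommGroup P] [AddCommGroup N] [Module R M] [Module R P] [Module R N]
  {gM : ModuleGrading gR M} {gP : ModuleGrading gR P} {gN : ModuleGrading gR N}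
  {φ : M →ₗ[R] P} {ψ : P →ₗ[R] N}

/-- A short exact sequence `0 → M → P → N → 0` of graded modules. -/
structure IsGradedShortExact (gM : ModuleGrading gR M) (gP : ModuleGrading gR P)
    (gN : ModuleGrading gR N) (φ : M →ₗ[R] P) (ψ : P →ₗ[R] N) : Prop where
  graded_left : IsGradedHom gM gP φ
  graded_right : IsGradedHom gP gN ψ
  injective : Function.Injective φ
  exact : Function.Exact φ ψ
  surjective : Function.Surjective ψ

/-- The map out of a direct sum of two free modules given by a map on each summand. -/
def sumCoprod {ι κ : Type} (f : (ι → R) →ₗ[R] P) (g : (κ → R) →ₗ[R] P) : (ι ⊕ κ → R) →ₗ[R] P :=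
  f ∘ₗ LinearMap.funLeft R R Sum.inl + g ∘ₗ LinearMap.funLeft R R Sum.inr

theorem sumCoprod_apply {ι κ : Type} (f : (ι → R) →ₗ[R] P) (g : (κ → R) →ₗ[R] P) (x : ι ⊕ κ → R) :
    sumCoprod f g x = f (x ∘ Sum.inl) + g (x ∘ Sum.inr) :=
  rfl

theorem IsGradedHom.sumCoprod {ι κ : Type} [Finite ι] [Finite κ] {a : ι → ℤ} {c : κ → ℤ}
    {f : (ι → R) →ₗ[R] P} {g : (κ → R) →ₗ[R] P} (hf : IsGradedHom (ModuleGrading.free gR a) gP f)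
    (hg : IsGradedHom (ModuleGrading.free gR c) gP g) :
    IsGradedHom (ModuleGrading.free gR (Sum.elim a c)) gP (sumCoprod f g) := fun j x => by
  rw [sumCoprod_apply, sumCoprod_apply, map_add, ← hf, ← hg]
  rfl

/-- The inclusion of the first summand of a direct sum of two free modules. -/
def sumInl (R : Type u) [CommRing R] (ι κ : Type) : (ι → R) →ₗ[R] (ι ⊕ κ → R) :=
  (LinearEquiv.sumArrowLequivProdArrow ι κ R R).symm.toLinearMap ∘ₗ LinearMap.inl R _ _

theorem sumInl_apply {ι κ : Type} (y : ι → R) : sumInl R ι κ y = Sum.elim y 0 :=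
  rfl

variable {ι κ : Type} {α : (ι → R) →ₗ[R] M} {γ : (κ → R) →ₗ[R] N} {σ : (κ → R) →ₗ[R] P}

theorem comp_inr_mem_ker_of_mem_ker_sumCoprod (hex : Function.Exact φ ψ) (hψσ : ψ ∘ₗ σ = γ)
    {x : ι ⊕ κ → R} (hx : x ∈ LinearMap.ker (sumCoprod (φ ∘ₗ α) σ)) :
    x ∘ Sum.inr ∈ LinearMap.ker γ := by
  have h := congrArg ψ (LinearMap.mem_ker.1 hx)
  rwa [sumCoprod_apply, map_add, LinearMap.comp_apply, hex.apply_apply_eq_zero, zero_add, map_zero,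
    ← LinearMap.comp_apply, hψσ] at h

variable [Finite ι] [Finite κ] {a : ι → ℤ} {c : κ → ℤ}

namespace IsGradedShortExact

theorem isMinimalCover_sumCoprod (hex : IsGradedShortExact gM gP gN φ ψ)
    (hpure : (I • (⊤ : Submodule R P)).comap φ ≤ I • ⊤) (hα : IsMinimalCover gM I a α)
    (hγ : IsMinimalCover gN I c γ) (hσ : IsGradedHom (ModuleGrading.free gR c) gP σ)
    (hψσ : ψ ∘ₗ σ = γ) : IsMinimalCover gP I (Sum.elim a c) (sumCoprod (φ ∘ₗ α) σ) where
  graded := (hex.graded_left.comp hα.graded).sumCoprod hσ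
  surjective p := by
    obtain ⟨z, hz⟩ := hγ.surjective (ψ p)
    obtain ⟨m, hm⟩ := (hex.exact (p - σ z)).1 <| by
      rw [map_sub, ← hz, ← hψσ, LinearMap.comp_apply, sub_self]
    obtain ⟨y, rfl⟩ := hα.surjective m
    exact ⟨Sum.elim y z, by
      rw [sumCoprod_apply, Sum.elim_comp_inl, Sum.elim_comp_inr, LinearMap.comp_apply, hm,
        sub_add_cancel]⟩
  ker_le x hx := by
    have hinr : x ∘ Sum.inr ∈ I • (⊤ : Submodule R (κ → R)) :=
      hγ.ker_le (comp_inr_mem_ker_of_mem_ker_sumCoprod hex.exact hψσ hx)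
    have hinl : x ∘ Sum.inl ∈ I • (⊤ : Submodule R (ι → R)) := by
      refine hα.apply_mem_smul_top_iff.1 (hpure ?_)
      have h : φ (α (x ∘ Sum.inl)) = -σ (x ∘ Sum.inr) := eq_neg_of_add_eq_zero_left hx
      rw [Submodule.mem_comap, h]
      exact neg_mem (Submodule.smul_top_le_comap_smul_top I σ hinr)
    exact mem_smul_top_pi_iff.2 <| Sum.rec (mem_smul_top_pi_iff.1 hinl) (mem_smul_top_pi_iff.1 hinr)

theorem exists_isMinimalCover_sumCoprod (hex : IsGradedShortExact gM gP gN φ ψ)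
    (hpure : (I • (⊤ : Submodule R P)).comap φ ≤ I • ⊤) (hα : IsMinimalCover gM I a α)
    (hγ : IsMinimalCover gN I c γ) :
    ∃ σ, IsMinimalCover gP I (Sum.elim a c) (sumCoprod (φ ∘ₗ α) σ) ∧ ψ ∘ₗ σ = γ := by
  obtain ⟨σ, hσ, hψσ⟩ := ModuleGrading.exists_isGradedHom_comp_eq hex.graded_right hγ.graded
    (by rw [LinearMap.range_eq_top.2 hex.surjective]; exact le_top)
  exact ⟨σ, hex.isMinimalCover_sumCoprod hpure hα hγ hσ hψσ, hψσ⟩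

theorem exists_ker_sumCoprod (hex : IsGradedShortExact gM gP gN φ ψ)
    (hα : IsGradedHom (ModuleGrading.free gR a) gM α) (hsurj : Function.Surjective α)
    (hγ : IsGradedHom (ModuleGrading.free gR c) gN γ)
    (hβ : IsGradedHom (ModuleGrading.free gR (Sum.elim a c)) gP (sumCoprod (φ ∘ₗ α) σ))
    (hψσ : ψ ∘ₗ σ = γ) :
    ∃ (φ' : LinearMap.ker α →ₗ[R] LinearMap.ker (sumCoprod (φ ∘ₗ α) σ))
      (ψ' : LinearMap.ker (sumCoprod (φ ∘ₗ α) σ) →ₗ[R] LinearMap.ker γ),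
      IsGradedShortExact hα.kerGrading hβ.kerGrading hγ.kerGrading φ' ψ' ∧
        ∀ y, (φ' y : ι ⊕ κ → R) = sumInl R ι κ y := by
  have hinl (y : ι → R) (hy : y ∈ LinearMap.ker α) :
      sumInl R ι κ y ∈ LinearMap.ker (sumCoprod (φ ∘ₗ α) σ) := by
    rw [LinearMap.mem_ker, sumCoprod_apply, sumInl_apply, Sum.elim_comp_inl, Sum.elim_comp_inr,
      map_zero, add_zero, LinearMap.comp_apply, LinearMap.mem_ker.1 hy, map_zero]
  refine ⟨(sumInl R ι κ).restrict hinl, (LinearMap.funLeft R R Sum.inr).restrict fun _ =>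
      comp_inr_mem_ker_of_mem_ker_sumCoprod hex.exact hψσ,
    ⟨?_, fun _ _ => rfl, ?_, ?_, ?_⟩, fun _ => rfl⟩
  · refine fun j y => Subtype.ext (funext (Sum.rec (fun _ => rfl) fun e => ?_))
    exact (map_zero (gR.proj (j - c e))).symm
  · exact fun y y' h => Subtype.ext (funext fun e => congrFun (congrArg Subtype.val h) (Sum.inl e))
  · refine fun x => ⟨fun hx => ?_, ?_⟩
    · have hx_inr : x.1 ∘ Sum.inr = 0 := congrArg Subtype.val hx
      have hx_ker := LinearMap.mem_ker.1 x.2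
      rw [sumCoprod_apply, hx_inr, map_zero, add_zero, LinearMap.comp_apply] at hx_ker
      refine ⟨⟨x.1 ∘ Sum.inl, hex.injective (hx_ker.trans (map_zero φ).symm)⟩, Subtype.ext ?_⟩
      exact funext (Sum.rec (fun _ => rfl) fun e => (congrFun hx_inr e).symm)
    · rintro ⟨y, rfl⟩
      rfl
  · intro z
    obtain ⟨m, hm⟩ := (hex.exact (σ z)).1 <| by
      rw [← LinearMap.comp_apply, hψσ, LinearMap.mem_ker.1 z.2]
    obtain ⟨y, rfl⟩ := hsurj m
    refine ⟨⟨Sum.elim (-y) z, ?_⟩, rfl⟩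
    rw [LinearMap.mem_ker, sumCoprod_apply, Sum.elim_comp_inl, Sum.elim_comp_inr, map_neg,
      LinearMap.comp_apply, hm, neg_add_cancel]

theorem comap_smul_top_le_of_sumInl {β : (ι ⊕ κ → R) →ₗ[R] P} (hβ : LinearMap.ker β ≤ I • ⊤)
    (hstrict : I ^ 2 • ⊤ ⊓ LinearMap.ker α ≤ I • LinearMap.ker α)
    {φ' : LinearMap.ker α →ₗ[R] LinearMap.ker β} (hφ' : ∀ y, (φ' y : ι ⊕ κ → R) = sumInl R ι κ y) :
    (I • (⊤ : Submodule R (LinearMap.ker β))).comap φ' ≤ I • ⊤ := by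
  intro y hy
  have hy_sq : sumInl R ι κ y ∈ I ^ 2 • (⊤ : Submodule R (ι ⊕ κ → R)) := by
    rw [pow_two, Submodule.mul_smul, ← hφ']
    exact Submodule.smul_mono le_rfl hβ ((Submodule.mem_smul_top_iff I _ _).1 hy)
  exact (Submodule.mem_smul_top_iff I _ _).2 <| hstrict
    ⟨mem_smul_top_pi_iff.2 fun e => mem_smul_top_pi_iff.1 hy_sq (Sum.inl e), y.2⟩

end IsGradedShortExact
end Horseshoe

section Strict

variable {R : Type u} [CommRing R] {gR : RingGrading R} {I : Ideal R}

/-- The resolution `F` satisfies `I² F_i ∩ d (F_{i+1}) = I d (F_{i+1})` in every degree `i`. This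
is the part of the acyclicity of the linear part of `F` on which the theorem rests. -/
def FreeRes.IsStrict {M : Type v} [AddCommGroup M] [Module R M] (F : FreeRes R M) (I : Ideal R) :
    Prop :=
  ∀ i, I ^ 2 • (⊤ : Submodule R (F.ι i → R)) ⊓ LinearMap.range (F.d i) ≤
    I • LinearMap.range (F.d i)

theorem FreeRes.IsStrict.inf_ker_aug_le {M : Type v} [AddCommGroup M] [Module R M]
    {F : FreeRes R M} (hF : F.IsStrict I) :
    I ^ 2 • ⊤ ⊓ LinearMap.ker F.aug ≤ I • LinearMap.ker F.aug := by
  rw [LinearMap.exact_iff.1 F.exact_zero]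
  exact hF 0

/-- Some minimal graded free resolution of `M` is strict. Koszul modules have this property. -/
def ModuleGrading.HasStrictResolution {M : Type v} [AddCommGroup M] [Module R M]
    (gM : ModuleGrading gR M) (I : Ideal R) : Prop :=
  ∃ F : HomogRes gM, F.IsMinimal I ∧ F.IsStrict I

section Cover

variable {M P N : Type u} [AddCommGroup M] [AddCommGroup P] [AddCommGroup N] [Module R M]
  [Module R P] [Module R N] {gM : ModuleGrading gR M} {gP : ModuleGrading gR P}
  {gN : ModuleGrading gR N} {φ : M →ₗ[R] P} {ψ : P →ₗ[R] N} {ι : Type} [Finite ι] {a : ι → ℤ}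
  {α : (ι → R) →ₗ[R] P}

theorem IsGradedShortExact.exists_ker_comp (hex : IsGradedShortExact gM gP gN φ ψ)
    (hα : IsGradedHom (ModuleGrading.free gR a) gP α) (hsurj : Function.Surjective α)
    (hψα : IsGradedHom (ModuleGrading.free gR a) gN (ψ ∘ₗ α)) :
    ∃ χ : LinearMap.ker (ψ ∘ₗ α) →ₗ[R] M,
      IsGradedShortExact hα.kerGrading hψα.kerGrading gM
        (Submodule.inclusion (LinearMap.ker_le_ker_comp α ψ)) χ := by
  have hmem (x : LinearMap.ker (ψ ∘ₗ α)) : α x ∈ LinearMap.range φ := (hex.exact _).1 x.2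
  let χ := (α ∘ₗ (LinearMap.ker (ψ ∘ₗ α)).subtype).codRestrictOfInjective φ hex.injective hmem
  have hχ (x : LinearMap.ker (ψ ∘ₗ α)) : φ (χ x) = α x :=
    LinearMap.codRestrictOfInjective_comp_apply ..
  refine ⟨χ, fun _ _ => rfl, fun j x => hex.injective ?_, Submodule.inclusion_injective _,
    fun x => ?_, fun m => ?_⟩
  · rw [hχ, hex.graded_left, hχ, ← hα]
    rfl
  · rw [← map_eq_zero_iff φ hex.injective, hχ]
    exact ⟨fun hx => ⟨⟨x, hx⟩, rfl⟩, fun ⟨y, hy⟩ => hy ▸ y.2⟩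
  · obtain ⟨x, hx⟩ := hsurj (φ m)
    have hx_ker : x ∈ LinearMap.ker (ψ ∘ₗ α) := by
      rw [LinearMap.mem_ker, LinearMap.comp_apply, hx, hex.exact.apply_apply_eq_zero]
    exact ⟨⟨x, hx_ker⟩, hex.injective ((hχ _).trans hx)⟩

theorem IsGradedShortExact.isMinimalCover_comp (hex : IsGradedShortExact gM gP gN φ ψ)
    (hsmall : LinearMap.range φ ≤ I • ⊤) (hα : IsMinimalCover gP I a α) :
    IsMinimalCover gN I a (ψ ∘ₗ α) where
  graded := hex.graded_right.comp hα.graded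
  surjective := hex.surjective.comp hα.surjective
  ker_le _ hx := hα.apply_mem_smul_top_iff.1 (hsmall ((hex.exact _).1 hx))

end Cover

variable [IsNoetherianRing R]

theorem IsGradedShortExact.torNeZero_iff_of_pure (hI : IsGradedLocal gR I) (i : ℕ) {j : ℤ}
    {M P N : Type u} [AddCommGroup M] [AddCommGroup P] [AddCommGroup N] [Module R M] [Module R P]
    [Module R N] [Module.Finite R N] {gM : ModuleGrading gR M} {gP : ModuleGrading gR P}
    {gN : ModuleGrading gR N} {φ : M →ₗ[R] P} {ψ : P →ₗ[R] N}
    (hex : IsGradedShortExact gM gP gN φ ψ) {F : HomogRes gM} (hF : F.IsMinimal I)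
    (hstrict : F.IsStrict I) (hpure : (I • (⊤ : Submodule R P)).comap φ ≤ I • ⊤) :
    gP.TorNeZero I i j ↔ gM.TorNeZero I i j ∨ gN.TorNeZero I i j := by
  induction i generalizing M P N with
  | zero =>
    obtain ⟨n, c, γ, hγ⟩ := exists_isMinimalCover hI gN
    obtain ⟨σ, hβ, -⟩ := hex.exists_isMinimalCover_sumCoprod hpure
      (HomogRes.isMinimalCover_aug hF) hγ
    rw [(HomogRes.isMinimalCover_aug hF).torNeZero_zero_iff hI, hβ.torNeZero_zero_iff hI,
      hγ.torNeZero_zero_iff hI, Sum.exists]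
    rfl
  | succ i ih =>
    obtain ⟨n, c, γ, hγ⟩ := exists_isMinimalCover hI gN
    obtain ⟨σ, hβ, hψσ⟩ :=
      hex.exists_isMinimalCover_sumCoprod hpure (HomogRes.isMinimalCover_aug hF) hγ
    obtain ⟨φ', ψ', hex', hφ'⟩ := hex.exists_ker_sumCoprod F.aug_graded F.aug_surjective hγ.graded
      hβ.graded hψσ
    rw [(HomogRes.isMinimalCover_aug hF).torNeZero_succ_iff hI, hβ.torNeZero_succ_iff hI,
      hγ.torNeZero_succ_iff hI]
    exact ih hex' (F := F.syzygy) (fun i => hF (i + 1)) (fun i => hstrict (i + 1))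
      (IsGradedShortExact.comap_smul_top_le_of_sumInl hβ.ker_le hstrict.inf_ker_aug_le hφ')

section Small

variable {M P N : Type u} [AddCommGroup M] [AddCommGroup P] [AddCommGroup N] [Module R M]
  [Module R P] [Module R N] {gM : ModuleGrading gR M} {gP : ModuleGrading gR P}
  {gN : ModuleGrading gR N} {φ : M →ₗ[R] P} {ψ : P →ₗ[R] N}

theorem IsGradedShortExact.torNeZero_zero_iff_of_small (hI : IsGradedLocal gR I)
    (hex : IsGradedShortExact gM gP gN φ ψ) {F : HomogRes gP} (hF : F.IsMinimal I)
    (hsmall : LinearMap.range φ ≤ I • ⊤) {j : ℤ} : gN.TorNeZero I 0 j ↔ gP.TorNeZero I 0 j := by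
  have hα := HomogRes.isMinimalCover_aug hF
  rw [hα.torNeZero_zero_iff hI, (hex.isMinimalCover_comp hsmall hα).torNeZero_zero_iff hI]

theorem IsGradedShortExact.torNeZero_succ_iff_of_small [Module.Finite R M]
    (hI : IsGradedLocal gR I) (hex : IsGradedShortExact gM gP gN φ ψ) {F : HomogRes gP}
    (hF : F.IsMinimal I) (hstrict : F.IsStrict I) (hsmall : LinearMap.range φ ≤ I • ⊤) {i : ℕ}
    {j : ℤ} :
    gN.TorNeZero I (i + 1) j ↔ gP.TorNeZero I (i + 1) j ∨ gM.TorNeZero I i j := by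
  have hα := HomogRes.isMinimalCover_aug hF
  have hψα := hex.isMinimalCover_comp hsmall hα
  obtain ⟨χ, hex'⟩ := hex.exists_ker_comp hα.graded hα.surjective hψα.graded
  rw [hα.torNeZero_succ_iff hI, hψα.torNeZero_succ_iff hI]
  refine hex'.torNeZero_iff_of_pure hI i (F := F.syzygy) (fun i => hF (i + 1))
    (fun i => hstrict (i + 1)) fun y hy => ?_
  have hy_sq : (y : F.ι 0 → R) ∈ I ^ 2 • (⊤ : Submodule R (F.ι 0 → R)) := by
    rw [pow_two, Submodule.mul_smul]
    exact Submodule.smul_mono le_rfl hψα.ker_le ((Submodule.mem_smul_top_iff I _ _).1 hy)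
  exact (Submodule.mem_smul_top_iff I _ _).2 (hstrict.inf_ker_aug_le ⟨hy_sq, y.2⟩)

end Small
end Strict

section ProjectiveDimension

variable {R : Type u} [CommRing R] {gR : RingGrading R} {I : Ideal R}

namespace IsMinimalCover

variable {M : Type v} [AddCommGroup M] [Module R M] {gM : ModuleGrading gR M} {ι : Type} [Finite ι]
  {a : ι → ℤ} {β : (ι → R) →ₗ[R] M}

theorem subsingleton_iff (hI : IsGradedLocal gR I) (hβ : IsMinimalCover gM I a β) :
    Subsingleton M ↔ IsEmpty ι := by
  refine ⟨fun _ => ⟨fun e => hI.ne_top ((Ideal.eq_top_iff_one I).2 ?_)⟩,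
    fun _ => hβ.surjective.subsingleton⟩
  exact mem_smul_top_pi_iff.1 (hβ.ker_le (x := 1) (Subsingleton.elim _ _)) e

theorem projective_iff (hI : IsGradedLocal gR I) (hβ : IsMinimalCover gM I a β) :
    Module.Projective R M ↔ Subsingleton (LinearMap.ker β) := by
  refine ⟨fun _ => ?_, fun _ => ?_⟩
  · obtain ⟨s, hs⟩ := Module.projective_lifting_property β LinearMap.id hβ.surjective
    let π : (ι → R) →ₗ[R] LinearMap.ker β :=
      (LinearMap.id - s ∘ₗ β).codRestrict _ fun x => by
        have hβs := LinearMap.congr_fun hs (β x)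
        rw [LinearMap.comp_apply, LinearMap.id_apply] at hβs
        rw [LinearMap.mem_ker, LinearMap.sub_apply, LinearMap.id_apply, map_sub,
          LinearMap.comp_apply, hβs, sub_self]
    have hπ (x : LinearMap.ker β) : π x = x := Subtype.ext <| by
      rw [LinearMap.codRestrict_apply, LinearMap.sub_apply, LinearMap.comp_apply,
        LinearMap.mem_ker.1 x.2, map_zero, sub_zero, LinearMap.id_apply]
    have : Module.Finite R (LinearMap.ker β) := Module.Finite.of_surjective π fun x => ⟨x, hπ x⟩
    refine hI.subsingleton_of_smul_top_eq_top hβ.graded.kerGrading ?_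
    exact Submodule.eq_top_iff'.2 fun x =>
      hπ x ▸ Submodule.smul_top_le_comap_smul_top I π (hβ.ker_le x.2)
  · have hinj := LinearMap.ker_eq_bot.1 (Submodule.subsingleton_iff_eq_bot.1 ‹_›)
    exact Module.Projective.of_equiv (LinearEquiv.ofBijective β ⟨hinj, hβ.surjective⟩)

end IsMinimalCover

namespace ModuleGrading

variable [IsNoetherianRing R] {M : Type v} [AddCommGroup M] [Module R M] [Module.Finite R M]

theorem subsingleton_iff_forall_not_torNeZero (hI : IsGradedLocal gR I) (gM : ModuleGrading gR M) :
    Subsingleton M ↔ ∀ j, ¬gM.TorNeZero I 0 j := by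
  obtain ⟨n, a, β, hβ⟩ := exists_isMinimalCover hI gM
  simp only [hβ.subsingleton_iff hI, hβ.torNeZero_zero_iff hI, not_exists, isEmpty_iff]
  exact ⟨fun h _ e => (h e).elim, fun h e => h _ e rfl⟩

open CategoryTheory in
theorem hasProjectiveDimensionLT_iff (hI : IsGradedLocal gR I) (n : ℕ) {M : Type u}
    [AddCommGroup M] [Module R M] [Module.Finite R M] (gM : ModuleGrading gR M) :
    HasProjectiveDimensionLT (ModuleCat.of R M) n ↔ ∀ j, ¬gM.TorNeZero I n j := by
  induction n using Nat.twoStepInduction generalizing M with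
  | zero =>
    rw [hasProjectiveDimensionLT_zero_iff_isZero, ModuleCat.isZero_iff_subsingleton,
      ← gM.subsingleton_iff_forall_not_torNeZero hI]
  | one =>
    obtain ⟨n, a, β, hβ⟩ := exists_isMinimalCover hI gM
    simp only [hβ.torNeZero_succ_iff hI]
    rw [← projective_iff_hasProjectiveDimensionLT_one, ← IsProjective.iff_projective,
      hβ.projective_iff hI, subsingleton_iff_forall_not_torNeZero hI]
  | more n _ ih =>
    obtain ⟨m, a, β, hβ⟩ := exists_isMinimalCover hI gM
    have hfree : Projective (ModuleCat.of R (Fin m → R)) :=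
      (IsProjective.iff_projective _).1 inferInstance
    simp only [hβ.torNeZero_succ_iff hI (i := n + 1)]
    exact ((LinearMap.shortExact_shortComplexKer hβ.surjective).hasProjectiveDimensionLT_X₃_iff n
      hfree).trans (ih _)

theorem projDim_lt_iff (hI : IsGradedLocal gR I) {M : Type u} [AddCommGroup M] [Module R M]
    [Module.Finite R M] (gM : ModuleGrading gR M) {n : ℕ} :
    projDim R M < n ↔ ∀ j, ¬gM.TorNeZero I n j :=
  CategoryTheory.projectiveDimension_lt_iff.trans (hasProjectiveDimensionLT_iff hI n gM)

end ModuleGrading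

theorem withBotENat_eq_of_forall_lt_natCast_iff {a b : WithBot ℕ∞} (h : ∀ n : ℕ, a < n ↔ b < n) :
    a = b := by
  refine eq_of_forall_gt_iff fun c => ?_
  obtain _ | _ | n := c
  · exact iff_of_false not_lt_bot not_lt_bot
  · change a < ⊤ ↔ b < ⊤
    simp only [lt_top_iff_ne_top, ne_eq, ENat.WithBot.eq_top_iff_forall_ge, ← not_lt, h]
  · exact h n

theorem withBotENat_add_one_lt_natCast_succ_iff {a : WithBot ℕ∞} {n : ℕ} :
    a + 1 < (n + 1 : ℕ) ↔ a < n := by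
  rw [Nat.cast_succ, ENat.WithBot.lt_add_one_iff, ENat.WithBot.add_one_le_natCast_iff]

section ShortExact

variable [IsNoetherianRing R] {M P N : Type u} [AddCommGroup M] [AddCommGroup P] [AddCommGroup N]
  [Module R M] [Module R P] [Module R N] [Module.Finite R M] [Module.Finite R P] [Module.Finite R N]
  {gM : ModuleGrading gR M} {gP : ModuleGrading gR P} {gN : ModuleGrading gR N}

theorem projDim_eq_max_of_torNeZero_iff (hI : IsGradedLocal gR I)
    (h : ∀ i j, gP.TorNeZero I i j ↔ gM.TorNeZero I i j ∨ gN.TorNeZero I i j) :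
    projDim R P = max (projDim R M) (projDim R N) := by
  refine withBotENat_eq_of_forall_lt_natCast_iff fun n => ?_
  rw [max_lt_iff, gP.projDim_lt_iff hI, gM.projDim_lt_iff hI, gN.projDim_lt_iff hI]
  simp only [h, not_or, forall_and]

theorem projDim_eq_max_add_one_of_torNeZero_iff (hI : IsGradedLocal gR I)
    (h_zero : ∀ j, gN.TorNeZero I 0 j ↔ gP.TorNeZero I 0 j)
    (h_succ : ∀ i j, gN.TorNeZero I (i + 1) j ↔ gP.TorNeZero I (i + 1) j ∨ gM.TorNeZero I i j)
    (hMP : Subsingleton P → Subsingleton M) :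
    projDim R N = max (projDim R M + 1) (projDim R P) := by
  refine withBotENat_eq_of_forall_lt_natCast_iff fun n => ?_
  rw [max_lt_iff, gN.projDim_lt_iff hI, gP.projDim_lt_iff hI]
  cases n with
  | zero =>
    simp only [h_zero, iff_and_self]
    intro hP
    have := hMP ((gP.subsingleton_iff_forall_not_torNeZero hI).2 hP)
    have hM : projDim R M = ⊥ := (CategoryTheory.projectiveDimension_eq_bot_iff _).2
      (ModuleCat.isZero_iff_subsingleton.2 this)
    rw [hM, WithBot.bot_add]
    exact WithBot.bot_lt_coe _
  | succ n =>
    rw [withBotENat_add_one_lt_natCast_succ_iff, gM.projDim_lt_iff hI, and_comm]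
    simp only [h_succ, not_or, forall_and]

end ShortExact
end ProjectiveDimension

section Regularity

variable {R : Type u} [CommRing R] {gR : RingGrading R} {I : Ideal R}

/-- The Castelnuovo-Mumford regularity `sup {j - i : Tor_i (R/I, M)_j ≠ 0}` of a graded module. -/
noncomputable def ModuleGrading.regularity {M : Type v} [AddCommGroup M] [Module R M]
    (gM : ModuleGrading gR M) (I : Ideal R) : EReal :=
  sSup {r | ∃ i j, gM.TorNeZero I i j ∧ r = (((j - (i : ℤ) : ℤ) : ℝ) : EReal)}

variable {M P N : Type*} [AddCommGroup M] [AddCommGroup P] [AddCommGroup N] [Module R M]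
  [Module R P] [Module R N] {gM : ModuleGrading gR M} {gP : ModuleGrading gR P}
  {gN : ModuleGrading gR N}

theorem ModuleGrading.regularity_le_iff {c : EReal} :
    gM.regularity I ≤ c ↔
      ∀ i j, gM.TorNeZero I i j → (((j - (i : ℤ) : ℤ) : ℝ) : EReal) ≤ c := by
  rw [regularity, sSup_le_iff]
  exact ⟨fun h i j hij => h _ ⟨i, j, hij, rfl⟩, fun h _ ⟨i, j, hij, hr⟩ => hr ▸ h i j hij⟩

theorem regularity_eq_max_of_torNeZero_iff
    (h : ∀ i j, gP.TorNeZero I i j ↔ gM.TorNeZero I i j ∨ gN.TorNeZero I i j) :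
    gP.regularity I = max (gM.regularity I) (gN.regularity I) := by
  refine eq_of_forall_ge_iff fun c => ?_
  simp only [max_le_iff, ModuleGrading.regularity_le_iff, h, or_imp, forall_and]

theorem ereal_sub_one_le_iff {a c : EReal} : a - 1 ≤ c ↔ a ≤ c + 1 :=
  EReal.sub_le_iff_le_add (.inl (EReal.coe_ne_bot 1)) (.inl (EReal.coe_ne_top 1))

theorem regularity_eq_max_sub_one_of_torNeZero_iff
    (h_zero : ∀ j, gN.TorNeZero I 0 j ↔ gP.TorNeZero I 0 j)
    (h_succ : ∀ i j, gN.TorNeZero I (i + 1) j ↔ gP.TorNeZero I (i + 1) j ∨ gM.TorNeZero I i j) :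
    gN.regularity I = max (gM.regularity I - 1) (gP.regularity I) := by
  have hshift (i : ℕ) (j : ℤ) :
      (((j - (i + 1 : ℕ) : ℤ) : ℝ) : EReal) = (((j - (i : ℤ) : ℤ) : ℝ) : EReal) - 1 := by
    rw [← EReal.coe_one, ← EReal.coe_sub, Nat.cast_succ, ← sub_sub, Int.cast_sub _ 1, Int.cast_one]
  refine eq_of_forall_ge_iff fun c => ?_
  simp only [max_le_iff, ereal_sub_one_le_iff, ModuleGrading.regularity_le_iff]
  rw [← Nat.and_forall_add_one]
  conv_rhs => rw [← Nat.and_forall_add_one (p := fun i => ∀ j, gP.TorNeZero I i j → _)]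
  simp only [h_zero, h_succ, or_imp, forall_and, hshift, ereal_sub_one_le_iff]
  tauto

end Regularity

section LinearPart

theorem mem_range_of_subsingleton_homologyOf {R : Type u} [CommRing R] {C : ℕ → Type*}
    [∀ i, AddCommGroup (C i)] [∀ i, Module R (C i)] {d : ∀ i, C (i + 1) →ₗ[R] C i} {i : ℕ}
    (h : Subsingleton (homologyOf d (i + 1))) {x : C (i + 1)} (hx : d i x = 0) :
    x ∈ LinearMap.range (d (i + 1)) := by
  rw [Submodule.Quotient.subsingleton_iff] at h
  have hx_mem : (⟨x, hx⟩ : cyclesOf d (i + 1)) ∈ (⊤ : Submodule R _) := Submodule.mem_top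
  rwa [← h] at hx_mem

namespace FreeRes

variable {R : Type u} [CommRing R] {M : Type v} [AddCommGroup M] [Module R M] {I : Ideal R}

theorem filt_self (F : FreeRes R M) (i : ℕ) : F.filt I i i = ⊤ := by
  rw [filt, Nat.sub_self, pow_zero, Ideal.one_eq_top, Submodule.top_smul]

theorem filt_succ_self (F : FreeRes R M) (i : ℕ) : F.filt I (i + 1) i = I • ⊤ := by
  rw [filt, Nat.add_sub_cancel_left, pow_one]

theorem exists_sub_mem_smul_top (F : FreeRes R M) (hF : F.IsMinimal I) {i : ℕ}
    (h : ¬F.LinHomologyNeZero hF (i + 1)) {y : F.ι (i + 1) → R}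
    (hy : F.d i y ∈ I ^ 2 • (⊤ : Submodule R (F.ι i → R))) :
    ∃ z, F.d (i + 1) z - y ∈ I • (⊤ : Submodule R (F.ι (i + 1) → R)) := by
  let y' : F.filt I (i + 1) (i + 1) := ⟨y, F.filt_self (i + 1) ▸ Submodule.mem_top⟩
  have hcycle : F.linPartD hF (i + 1) i (Submodule.Quotient.mk y') = 0 := by
    refine (Submodule.Quotient.mk_eq_zero _).2 ?_
    change F.d i y ∈ I ^ (i + 1 + 1 - i) • (⊤ : Submodule R (F.ι i → R))
    rwa [add_assoc, Nat.add_sub_cancel_left]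
  have hacyclic := not_nontrivial_iff_subsingleton.1 (not_exists.1 h (i + 1))
  obtain ⟨z, hz⟩ := mem_range_of_subsingleton_homologyOf hacyclic hcycle
  obtain ⟨z, rfl⟩ := Submodule.Quotient.mk_surjective _ z
  have hzy := (Submodule.Quotient.eq _).1 hz
  change F.d (i + 1) z - y ∈ F.filt I (i + 1 + 1) (i + 1) at hzy
  exact ⟨z, F.filt_succ_self (I := I) (i + 1) ▸ hzy⟩

theorem isStrict_of_not_linHomologyNeZero (F : FreeRes R M) (hF : F.IsMinimal I)
    (h : ∀ i, ¬F.LinHomologyNeZero hF (i + 1)) : F.IsStrict I := by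
  rintro i _ ⟨hy, y, rfl⟩
  obtain ⟨z, hz⟩ := F.exists_sub_mem_smul_top hF (h i) hy
  have hy_mem : y ∈ I • (⊤ : Submodule R (F.ι (i + 1) → R)) :=
    sub_sub_cancel (F.d (i + 1) z) y ▸ sub_mem (hF (i + 1) ⟨z, rfl⟩) hz
  rw [← Submodule.map_top, ← Submodule.map_smul'']
  exact Submodule.mem_map_of_mem hy_mem

end FreeRes
end LinearPart

section Tor

variable {R : Type u} [CommRing R] {I : Ideal R} {M : Type v} [AddCommGroup M] [Module R M]

theorem one_tmul_eq_zero_iff {x : M} :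
    (1 : R ⧸ I) ⊗ₜ[R] x = 0 ↔ x ∈ I • (⊤ : Submodule R M) := by
  rw [← (TensorProduct.quotTensorEquivQuotSMul M I).map_eq_zero_iff,
    ← map_one (Ideal.Quotient.mk I), TensorProduct.quotTensorEquivQuotSMul_mk_tmul, one_smul,
    Submodule.Quotient.mk_eq_zero]

namespace FreeRes

theorem one_tmul_mem_cyclesOf_iff (F : FreeRes R M) {i : ℕ} {x : F.ι i → R} :
    (1 : R ⧸ I) ⊗ₜ[R] x ∈ cyclesOf (C := fun l => (R ⧸ I) ⊗[R] (F.ι l → R)) (F.residueD I) i ↔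
      x ∈ F.torCycles I i := by
  cases i with
  | zero => exact Iff.rfl
  | succ i => exact one_tmul_eq_zero_iff

theorem one_tmul_mem_range_residueD_iff (F : FreeRes R M) {i : ℕ} {x : F.ι i → R} :
    (1 : R ⧸ I) ⊗ₜ[R] x ∈ LinearMap.range (F.residueD I i) ↔
      x ∈ LinearMap.range (F.d i) ⊔ I • ⊤ := by
  have hsurj := TensorProduct.mk_surjective R (F.ι (i + 1) → R) (R ⧸ I)
    Ideal.Quotient.mk_surjective
  have hmk (y : F.ι (i + 1) → R) :
      F.residueD I i (1 ⊗ₜ y) = 1 ⊗ₜ x ↔ x - F.d i y ∈ I • (⊤ : Submodule R (F.ι i → R)) := by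
    rw [← one_tmul_eq_zero_iff, TensorProduct.tmul_sub, sub_eq_zero, eq_comm]
    rfl
  rw [LinearMap.mem_range, hsurj.exists, Submodule.mem_sup]
  simp only [TensorProduct.mk_apply, hmk, LinearMap.mem_range, exists_exists_eq_and]
  exact exists_congr fun y => ⟨fun h => ⟨_, h, add_sub_cancel _ _⟩,
    fun ⟨w, hw, h⟩ => by rwa [← h, add_sub_cancel_left]⟩

end FreeRes

theorem GradedFreeRes.torPiece_ne_bot_iff {k : Type w} [Field k] [Algebra k R]
    {𝒜 : ℤ → Submodule k R} {ℳ : ℤ → AddSubgroup M} (F : GradedFreeRes 𝒜 ℳ) {i : ℕ} {j : ℤ} :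
    F.torPiece i j ≠ ⊥ ↔ ∃ x ∈ freePiece 𝒜 (F.deg i) j, x ∈ F.torCycles (gradedMaxIdeal 𝒜) i ∧
      x ∉ LinearMap.range (F.d i) ⊔ gradedMaxIdeal 𝒜 • ⊤ := by
  rw [AddSubgroup.ne_bot_iff_exists_ne_zero]
  constructor
  · rintro ⟨⟨_, ⟨c, hcycle⟩, ⟨x, hx, hxc⟩, rfl⟩, hne⟩
    obtain rfl : 1 ⊗ₜ x = c := hxc
    refine ⟨x, hx, F.one_tmul_mem_cyclesOf_iff.1 hcycle, fun h => hne (Subtype.ext ?_)⟩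
    exact (Submodule.Quotient.mk_eq_zero _).2 (F.one_tmul_mem_range_residueD_iff.2 h)
  · rintro ⟨x, hx, hcycle, hboundary⟩
    refine ⟨⟨_, ⟨1 ⊗ₜ x, F.one_tmul_mem_cyclesOf_iff.2 hcycle⟩, ⟨x, hx, rfl⟩, rfl⟩,
      fun h => hboundary ?_⟩
    have hrange := (Submodule.Quotient.mk_eq_zero _).1 (congrArg Subtype.val h)
    exact F.one_tmul_mem_range_residueD_iff.1 hrange

end Tor

section Trivial

variable {R : Type u} [CommRing R] {M N : Type*} [AddCommGroup M] [AddCommGroup N]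

/-- The grading concentrated in degree `0`. -/
def IntGrading.trivial (M : Type*) [AddCommGroup M] : IntGrading M where
  proj j := if j = 0 then AddMonoidHom.id M else 0
  proj_proj i j x := by
    by_cases hi : i = 0 <;> by_cases hj : j = 0 <;> simp [hi, hj, eq_comm]
  exists_sum_proj x := ⟨{0}, by simp⟩

theorem IntGrading.mem_piece_trivial_iff {j : ℤ} {x : M} :
    x ∈ (IntGrading.trivial M).piece j ↔ j ≠ 0 → x = 0 := by
  by_cases hj : j = 0 <;> simp [mem_piece, IntGrading.trivial, hj, eq_comm]

/-- The ring grading concentrated in degree `0`. -/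
def RingGrading.trivial (R : Type u) [CommRing R] : RingGrading R where
  toIntGrading := .trivial R
  mul_mem {i j r s} hr hs := by
    rw [IntGrading.mem_piece_trivial_iff] at hr hs ⊢
    intro hij
    obtain rfl | hi := eq_or_ne i 0
    · rw [hs (by rwa [zero_add] at hij), mul_zero]
    · rw [hr hi, zero_mul]
  one_mem := IntGrading.mem_piece_trivial_iff.2 fun h => absurd rfl h

/-- The module grading concentrated in degree `0`. -/
def ModuleGrading.trivial (R : Type u) [CommRing R] (M : Type*) [AddCommGroup M] [Module R M] :
    ModuleGrading (RingGrading.trivial R) M where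
  toIntGrading := .trivial M
  smul_mem {i j r x} hr hx := by
    rw [RingGrading.trivial, IntGrading.mem_piece_trivial_iff] at hr
    rw [IntGrading.mem_piece_trivial_iff] at hx ⊢
    intro hij
    obtain rfl | hi := eq_or_ne i 0
    · rw [hx (by rwa [zero_add] at hij), smul_zero]
    · rw [hr hi, zero_smul]

theorem isGradedHom_trivial [Module R M] [Module R N] (f : M →ₗ[R] N) :
    IsGradedHom (ModuleGrading.trivial R M) (ModuleGrading.trivial R N) f :=
  .of_map_mem fun j x hx => by
    rw [ModuleGrading.trivial, IntGrading.mem_piece_trivial_iff] at hx ⊢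
    exact fun hj => by rw [hx hj, map_zero]

theorem isGradedLocal_maximalIdeal (R : Type u) [CommRing R] [IsLocalRing R] :
    IsGradedLocal (RingGrading.trivial R) (IsLocalRing.maximalIdeal R) where
  ne_top := Ideal.IsPrime.ne_top'
  isUnit_proj_zero _ hr := IsLocalRing.notMem_maximalIdeal.1 hr

theorem IsKoszulModule.hasStrictResolution [IsLocalRing R] [IsNoetherianRing R] [Module R M]
    [Module.Finite R M] (h : IsKoszulModule R M) :
    (ModuleGrading.trivial R M).HasStrictResolution (IsLocalRing.maximalIdeal R) := by
  obtain ⟨F, hF⟩ := exists_isMinimal_homogRes (isGradedLocal_maximalIdeal R) (.trivial R M)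
  refine ⟨F, hF, F.isStrict_of_not_linHomologyNeZero hF fun i hi => ?_⟩
  exact Nat.cast_ne_zero.2 i.succ_ne_zero
    (ENat.sSup_eq_zero.1 h _ ⟨F.toFreeRes, hF, i + 1, hi, rfl⟩)

end Trivial

section Decomposition

open DirectSum

/-- The grading given by a direct sum decomposition. -/
def IntGrading.ofDecomposition {M σ : Type*} [AddCommGroup M] [SetLike σ M]
    [AddSubmonoidClass σ M] (ℳ : ℤ → σ) [Decomposition ℳ] : IntGrading M where
  proj j :=
    { toFun := fun x => decompose ℳ x j
      map_zero' := by rw [decompose_zero, DirectSum.zero_apply, ZeroMemClass.coe_zero]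
      map_add' := fun x y => by rw [decompose_add, DirectSum.add_apply, AddMemClass.coe_add] }
  proj_proj i j x := by
    simp only [AddMonoidHom.coe_mk, ZeroHom.coe_mk]
    split_ifs with h
    · rw [h, decompose_of_mem_same ℳ (SetLike.coe_mem _)]
    · exact decompose_of_mem_ne ℳ (SetLike.coe_mem _) (Ne.symm h)
  exists_sum_proj x := by
    classical
    exact ⟨_, sum_support_decompose ℳ x⟩

theorem IntGrading.mem_piece_ofDecomposition_iff {M σ : Type*} [AddCommGroup M] [SetLike σ M]
    [AddSubmonoidClass σ M] {ℳ : ℤ → σ} [Decomposition ℳ] {j : ℤ} {x : M} :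
    x ∈ (ofDecomposition ℳ).piece j ↔ x ∈ ℳ j :=
  ⟨fun h => mem_piece.1 h ▸ SetLike.coe_mem (decompose ℳ x j), decompose_of_mem_same ℳ⟩

variable {R σ M τ : Type*} [CommRing R] [SetLike σ R] [AddSubmonoidClass σ R] (𝒜 : ℤ → σ)
  [GradedRing 𝒜] [AddCommGroup M] [Module R M] [SetLike τ M] [AddSubmonoidClass τ M]

/-- The grading of a ring given by a direct sum decomposition. -/
def RingGrading.ofDecomposition : RingGrading R where
  toIntGrading := .ofDecomposition 𝒜
  mul_mem hr hs := by
    rw [IntGrading.mem_piece_ofDecomposition_iff] at hr hs ⊢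
    exact SetLike.GradedMul.mul_mem hr hs
  one_mem := IntGrading.mem_piece_ofDecomposition_iff.2 SetLike.GradedOne.one_mem

/-- The grading of a module given by a direct sum decomposition. -/
def ModuleGrading.ofDecomposition (ℳ : ℤ → τ) [Decomposition ℳ] [SetLike.GradedSMul 𝒜 ℳ] :
    ModuleGrading (RingGrading.ofDecomposition 𝒜) M where
  toIntGrading := .ofDecomposition ℳ
  smul_mem hr hx := by
    rw [RingGrading.ofDecomposition, IntGrading.mem_piece_ofDecomposition_iff] at hr
    rw [IntGrading.mem_piece_ofDecomposition_iff] at hx ⊢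
    exact SetLike.GradedSMul.smul_mem hr hx

theorem isGradedHom_ofDecomposition {N τ' : Type*} [AddCommGroup N] [Module R N] [SetLike τ' N]
    [AddSubmonoidClass τ' N] {ℳ : ℤ → τ} [Decomposition ℳ] [SetLike.GradedSMul 𝒜 ℳ] {𝒩 : ℤ → τ'}
    [Decomposition 𝒩] [SetLike.GradedSMul 𝒜 𝒩] {f : M →ₗ[R] N}
    (hf : ∀ j, ∀ x ∈ ℳ j, f x ∈ 𝒩 j) :
    IsGradedHom (ModuleGrading.ofDecomposition 𝒜 ℳ) (ModuleGrading.ofDecomposition 𝒜 𝒩) f :=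
  .of_map_mem fun j x hx => IntGrading.mem_piece_ofDecomposition_iff.2
    (hf j x (IntGrading.mem_piece_ofDecomposition_iff.1 hx))

end Decomposition

section StandardGraded

theorem RingGrading.proj_zero_mul {R : Type u} [CommRing R] {gR : RingGrading R}
    (hneg : ∀ i < 0, ∀ r ∈ gR.piece i, r = 0) (r s : R) :
    gR.proj 0 (r * s) = gR.proj 0 r * gR.proj 0 s := by
  induction r using gR.induction_on with
  | zero => simp only [zero_mul, map_zero]
  | add r r' hr hr' => simp only [add_mul, map_add, hr, hr']
  | homogeneous i r hr =>
    induction s using gR.induction_on with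
    | zero => simp only [mul_zero, map_zero]
    | add s s' hs hs' => simp only [mul_add, map_add, hs, hs']
    | homogeneous j s hs =>
      rw [IntGrading.proj_eq_ite hr, IntGrading.proj_eq_ite hs,
        IntGrading.proj_eq_ite (gR.mul_mem hr hs), ite_zero_mul_ite_zero]
      obtain hi | hi := lt_or_ge i 0
      · simp only [hneg i hi r hr, zero_mul, ite_self]
      obtain hj | hj := lt_or_ge j 0
      · simp only [hneg j hj s hs, mul_zero, ite_self]
      exact if_congr (by omega) rfl rfl

variable {k : Type w} [Field k] {R : Type u} [CommRing R] [Algebra k R] {𝒜 : ℤ → Submodule k R}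
  [GradedAlgebra 𝒜]

namespace IsStandardGraded

theorem eq_zero_of_mem_piece (h : IsStandardGraded 𝒜) {i : ℤ} (hi : i < 0) {x : R}
    (hx : x ∈ (RingGrading.ofDecomposition 𝒜).piece i) : x = 0 := by
  have hx' : x ∈ 𝒜 i := IntGrading.mem_piece_ofDecomposition_iff.1 hx
  rwa [h.neg i hi] at hx'

theorem mem_gradedMaxIdeal_iff (h : IsStandardGraded 𝒜) {x : R} :
    x ∈ gradedMaxIdeal 𝒜 ↔ (RingGrading.ofDecomposition 𝒜).proj 0 x = 0 := by
  refine ⟨fun hx => ?_, fun hx => ?_⟩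
  · induction hx using Submodule.span_induction with
    | mem x hx =>
      obtain ⟨i, hi, hx⟩ := hx
      exact (IntGrading.proj_eq_ite (IntGrading.mem_piece_ofDecomposition_iff.2 hx)).trans
        (if_neg hi.ne)
    | zero => exact map_zero _
    | add x y _ _ hx hy => rw [map_add, hx, hy, add_zero]
    | smul r x _ hx =>
      rw [smul_eq_mul, RingGrading.proj_zero_mul (fun _ hi _ => h.eq_zero_of_mem_piece hi), hx,
        mul_zero]
  · obtain ⟨s, hs⟩ := (RingGrading.ofDecomposition 𝒜).exists_sum_proj x
    rw [← hs]
    refine Submodule.sum_mem _ fun i _ => ?_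
    have hmem := IntGrading.proj_mem (g := (RingGrading.ofDecomposition 𝒜).toIntGrading) i x
    obtain hi | rfl | hi := lt_trichotomy i 0
    · rw [h.eq_zero_of_mem_piece hi hmem]
      exact zero_mem _
    · rw [hx]
      exact zero_mem _
    · exact Ideal.subset_span ⟨i, hi, IntGrading.mem_piece_ofDecomposition_iff.1 hmem⟩

theorem isGradedLocal (h : IsStandardGraded 𝒜) :
    IsGradedLocal (RingGrading.ofDecomposition 𝒜) (gradedMaxIdeal 𝒜) where
  ne_top := by
    have := h.nontrivial
    rw [Ne, Ideal.eq_top_iff_one, h.mem_gradedMaxIdeal_iff,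
      IntGrading.mem_piece.1 (RingGrading.ofDecomposition 𝒜).one_mem]
    exact one_ne_zero
  isUnit_proj_zero r hr := by
    rw [h.mem_gradedMaxIdeal_iff] at hr
    have hmem : (RingGrading.ofDecomposition 𝒜).proj 0 r ∈ 𝒜 0 :=
      IntGrading.mem_piece_ofDecomposition_iff.1 (IntGrading.proj_mem 0 r)
    rw [h.zero] at hmem
    obtain ⟨c, hc⟩ := hmem
    rw [← hc] at hr ⊢
    exact (IsUnit.mk0 c fun hc => hr (by rw [hc, map_zero])).map (algebraMap k R)

theorem isNoetherianRing (h : IsStandardGraded 𝒜) : IsNoetherianRing R := by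
  obtain ⟨S, hS⟩ := Module.Finite.iff_fg.1 h.finite_one
  have : Algebra.FiniteType k R := ⟨⟨S, by rw [← Algebra.adjoin_span, hS, h.adjoin_one]⟩⟩
  exact Algebra.FiniteType.isNoetherianRing k R

end IsStandardGraded

theorem mem_freePiece_iff {ι : Type} [Finite ι] {a : ι → ℤ} {j : ℤ} {x : ι → R} :
    x ∈ freePiece 𝒜 a j ↔
      x ∈ (ModuleGrading.free (RingGrading.ofDecomposition 𝒜) a).piece j := by
  rw [IntGrading.mem_piece, funext_iff]
  exact forall_congr' fun e => IntGrading.mem_piece_ofDecomposition_iff.symm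

variable {M : Type v} [AddCommGroup M] [Module R M] {ℳ : ℤ → AddSubgroup M}
  [DirectSum.Decomposition ℳ] [SetLike.GradedSMul 𝒜 ℳ]

/-- A graded free resolution, regarded as a resolution for the associated gradings by
projections. -/
def GradedFreeRes.toHomogRes (F : GradedFreeRes 𝒜 ℳ) :
    HomogRes (ModuleGrading.ofDecomposition 𝒜 ℳ) where
  toFreeRes := F.toFreeRes
  deg := F.deg
  d_graded i := .of_map_mem fun j x hx =>
    mem_freePiece_iff.1 (F.d_mem i j x (mem_freePiece_iff.2 hx))
  aug_graded := .of_map_mem fun j x hx =>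
    IntGrading.mem_piece_ofDecomposition_iff.2 (F.aug_mem j x (mem_freePiece_iff.2 hx))

/-- A graded free resolution for gradings by projections, regarded as one for the decompositions
they come from. -/
def HomogRes.toGradedFreeRes (F : HomogRes (ModuleGrading.ofDecomposition 𝒜 ℳ)) :
    GradedFreeRes 𝒜 ℳ where
  toFreeRes := F.toFreeRes
  deg := F.deg
  d_mem i _ _ hx := mem_freePiece_iff.2 ((F.d_graded i).map_mem (mem_freePiece_iff.1 hx))
  aug_mem _ _ hx := IntGrading.mem_piece_ofDecomposition_iff.1
    (F.aug_graded.map_mem (mem_freePiece_iff.1 hx))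

theorem GradedFreeRes.torPiece_ne_bot_iff_torNeZero {F : GradedFreeRes 𝒜 ℳ} {i : ℕ} {j : ℤ} :
    F.torPiece i j ≠ ⊥ ↔ F.toHomogRes.TorNeZero (gradedMaxIdeal 𝒜) i j := by
  simp only [F.torPiece_ne_bot_iff, mem_freePiece_iff]
  rfl

theorem regularity_eq_regularity_ofDecomposition :
    regularity 𝒜 ℳ = (ModuleGrading.ofDecomposition 𝒜 ℳ).regularity (gradedMaxIdeal 𝒜) := by
  simp only [regularity, ModuleGrading.regularity, ModuleGrading.TorNeZero]
  congr 1
  ext r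
  constructor
  · rintro ⟨F, i, j, hF, hr⟩
    exact ⟨i, j, ⟨F.toHomogRes, F.torPiece_ne_bot_iff_torNeZero.1 hF⟩, hr⟩
  · rintro ⟨i, j, ⟨F, hF⟩, hr⟩
    exact ⟨F.toGradedFreeRes, i, j, GradedFreeRes.torPiece_ne_bot_iff_torNeZero.2 hF, hr⟩

theorem IsGradedKoszulModule.hasStrictResolution [Module.Finite R M] (hA : IsStandardGraded 𝒜)
    (h : IsGradedKoszulModule 𝒜 ℳ) :
    (ModuleGrading.ofDecomposition 𝒜 ℳ).HasStrictResolution (gradedMaxIdeal 𝒜) := by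
  have := hA.isNoetherianRing
  obtain ⟨F, hF⟩ := exists_isMinimal_homogRes hA.isGradedLocal (.ofDecomposition 𝒜 ℳ)
  refine ⟨F, hF, F.isStrict_of_not_linHomologyNeZero hF fun i hi => ?_⟩
  exact Nat.cast_ne_zero.2 i.succ_ne_zero
    (ENat.sSup_eq_zero.1 h _ ⟨F.toGradedFreeRes, hF, i + 1, hi, rfl⟩)

end StandardGraded

theorem corollary3p6_general {R : Type u} [CommRing R] [IsNoetherianRing R] {gR : RingGrading R}
    {I : Ideal R} (hI : IsGradedLocal gR I) {M P N : Type u} [AddCommGroup M] [AddCommGroup P]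
    [AddCommGroup N] [Module R M] [Module R P] [Module R N] [Module.Finite R P]
    {gM : ModuleGrading gR M} {gP : ModuleGrading gR P} {gN : ModuleGrading gR N}
    {φ : M →ₗ[R] P} {ψ : P →ₗ[R] N} (hex : IsGradedShortExact gM gP gN φ ψ) :
    (gM.HasStrictResolution I → LinearMap.range φ ⊓ I • ⊤ = I • LinearMap.range φ →
      projDim R P = max (projDim R M) (projDim R N) ∧
        gP.regularity I = max (gM.regularity I) (gN.regularity I)) ∧
    (gP.HasStrictResolution I → LinearMap.range φ ≤ I • ⊤ →
      projDim R N = max (projDim R M + 1) (projDim R P) ∧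
        gN.regularity I = max (gM.regularity I - 1) (gP.regularity I)) := by
  have : Module.Finite R M := Module.Finite.of_injective φ hex.injective
  have : Module.Finite R N := Module.Finite.of_surjective ψ hex.surjective
  constructor
  · rintro ⟨F, hF, hstrict⟩ hpure
    have hcomap : (I • (⊤ : Submodule R P)).comap φ ≤ I • ⊤ := by
      rw [← Submodule.map_le_map_iff_of_injective hex.injective, Submodule.map_comap_eq, hpure,
        Submodule.map_smul'', Submodule.map_top]
    have hTor i j := hex.torNeZero_iff_of_pure hI i (j := j) hF hstrict hcomap
    exact ⟨projDim_eq_max_of_torNeZero_iff hI hTor, regularity_eq_max_of_torNeZero_iff hTor⟩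
  · rintro ⟨F, hF, hstrict⟩ hsmall
    have hTor_zero j := hex.torNeZero_zero_iff_of_small hI hF hsmall (j := j)
    have hTor_succ i j := hex.torNeZero_succ_iff_of_small hI hF hstrict hsmall (i := i) (j := j)
    exact ⟨projDim_eq_max_add_one_of_torNeZero_iff hI hTor_zero hTor_succ
      fun _ => hex.injective.subsingleton,
      regularity_eq_max_sub_one_of_torNeZero_iff hTor_zero hTor_succ⟩

theorem corollary3p6 :
    -- pure extensions, over a noetherian local ring
    (∀ (R : Type u) [CommRing R] [IsLocalRing R] [IsNoetherianRing R]
        (M P N : Type u) [AddCommGroup M] [AddCommGroup P] [AddCommGroup N]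
        [Module R M] [Module R P] [Module R N]
        [Module.Finite R M] [Module.Finite R P] [Module.Finite R N]
        [Nontrivial M] [Nontrivial P] [Nontrivial N]
        (φ : M →ₗ[R] P) (ψ : P →ₗ[R] N),
        Function.Injective φ → Function.Exact φ ψ → Function.Surjective ψ →
        IsKoszulModule R M →
        LinearMap.range φ ⊓ IsLocalRing.maximalIdeal R • (⊤ : Submodule R P) =
          IsLocalRing.maximalIdeal R • LinearMap.range φ →
        projDim R P = max (projDim R M) (projDim R N)) ∧
    -- pure extensions, over a standard graded algebra
    (∀ (k : Type w) [Field k] (R : Type u) [CommRing R] [Algebra k R]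
        (𝒜 : ℤ → Submodule k R) [GradedAlgebra 𝒜]
        (M P N : Type u) [AddCommGroup M] [AddCommGroup P] [AddCommGroup N]
        [Module R M] [Module R P] [Module R N]
        [Module.Finite R M] [Module.Finite R P] [Module.Finite R N]
        [Nontrivial M] [Nontrivial P] [Nontrivial N]
        (gM : ℤ → AddSubgroup M) [DirectSum.Decomposition gM] [SetLike.GradedSMul 𝒜 gM]
        (gP : ℤ → AddSubgroup P) [DirectSum.Decomposition gP] [SetLike.GradedSMul 𝒜 gP]
        (gN : ℤ → AddSubgroup N) [DirectSum.Decomposition gN] [SetLike.GradedSMul 𝒜 gN]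
        (φ : M →ₗ[R] P) (ψ : P →ₗ[R] N),
        IsStandardGraded 𝒜 →
        (∀ j, ∀ x ∈ gM j, φ x ∈ gP j) → (∀ j, ∀ x ∈ gP j, ψ x ∈ gN j) →
        Function.Injective φ → Function.Exact φ ψ → Function.Surjective ψ →
        IsGradedKoszulModule 𝒜 gM →
        LinearMap.range φ ⊓ gradedMaxIdeal 𝒜 • (⊤ : Submodule R P) =
          gradedMaxIdeal 𝒜 • LinearMap.range φ →
        projDim R P = max (projDim R M) (projDim R N) ∧
        regularity 𝒜 gP = max (regularity 𝒜 gM) (regularity 𝒜 gN)) ∧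
    -- small inclusions, over a noetherian local ring
    (∀ (R : Type u) [CommRing R] [IsLocalRing R] [IsNoetherianRing R]
        (M P N : Type u) [AddCommGroup M] [AddCommGroup P] [AddCommGroup N]
        [Module R M] [Module R P] [Module R N]
        [Module.Finite R M] [Module.Finite R P] [Module.Finite R N]
        [Nontrivial M] [Nontrivial P] [Nontrivial N]
        (φ : M →ₗ[R] P) (ψ : P →ₗ[R] N),
        Function.Injective φ → Function.Exact φ ψ → Function.Surjective ψ →
        IsKoszulModule R P →
        LinearMap.range φ ≤ IsLocalRing.maximalIdeal R • (⊤ : Submodule R P) →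
        projDim R N = max (projDim R M + 1) (projDim R P)) ∧
    -- small inclusions, over a standard graded algebra
    (∀ (k : Type w) [Field k] (R : Type u) [CommRing R] [Algebra k R]
        (𝒜 : ℤ → Submodule k R) [GradedAlgebra 𝒜]
        (M P N : Type u) [AddCommGroup M] [AddCommGroup P] [AddCommGroup N]
        [Module R M] [Module R P] [Module R N]
        [Module.Finite R M] [Module.Finite R P] [Module.Finite R N]
        [Nontrivial M] [Nontrivial P] [Nontrivial N]
        (gM : ℤ → AddSubgroup M) [DirectSum.Decomposition gM] [SetLike.GradedSMul 𝒜 gM]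
        (gP : ℤ → AddSubgroup P) [DirectSum.Decomposition gP] [SetLike.GradedSMul 𝒜 gP]
        (gN : ℤ → AddSubgroup N) [DirectSum.Decomposition gN] [SetLike.GradedSMul 𝒜 gN]
        (φ : M →ₗ[R] P) (ψ : P →ₗ[R] N),
        IsStandardGraded 𝒜 →
        (∀ j, ∀ x ∈ gM j, φ x ∈ gP j) → (∀ j, ∀ x ∈ gP j, ψ x ∈ gN j) →
        Function.Injective φ → Function.Exact φ ψ → Function.Surjective ψ →
        IsGradedKoszulModule 𝒜 gP →
        LinearMap.range φ ≤ gradedMaxIdeal 𝒜 • (⊤ : Submodule R P) →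
        projDim R N = max (projDim R M + 1) (projDim R P) ∧
        regularity 𝒜 gN = max (regularity 𝒜 gM - 1) (regularity 𝒜 gP)) := by
  refine ⟨?_, ?_, ?_, ?_⟩
  · intro R _ _ _ M P N _ _ _ _ _ _ _ _ _ _ _ _ φ ψ hinj hexact hsurj hK hpure
    have hex : IsGradedShortExact (.trivial R M) (.trivial R P) (.trivial R N) φ ψ :=
      ⟨isGradedHom_trivial φ, isGradedHom_trivial ψ, hinj, hexact, hsurj⟩
    exact ((corollary3p6_general (isGradedLocal_maximalIdeal R) hex).1
      hK.hasStrictResolution hpure).1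
  · intro k _ R _ _ 𝒜 _ M P N _ _ _ _ _ _ _ _ _ _ _ _ gM _ _ gP _ _ gN _ _ φ ψ hA hφ hψ hinj
      hexact hsurj hK hpure
    have := hA.isNoetherianRing
    simp only [regularity_eq_regularity_ofDecomposition]
    exact (corollary3p6_general hA.isGradedLocal ⟨isGradedHom_ofDecomposition 𝒜 hφ,
      isGradedHom_ofDecomposition 𝒜 hψ, hinj, hexact, hsurj⟩).1 (hK.hasStrictResolution hA) hpure
  · intro R _ _ _ M P N _ _ _ _ _ _ _ _ _ _ _ _ φ ψ hinj hexact hsurj hK hsmall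
    have hex : IsGradedShortExact (.trivial R M) (.trivial R P) (.trivial R N) φ ψ :=
      ⟨isGradedHom_trivial φ, isGradedHom_trivial ψ, hinj, hexact, hsurj⟩
    exact ((corollary3p6_general (isGradedLocal_maximalIdeal R) hex).2
      hK.hasStrictResolution hsmall).1
  · intro k _ R _ _ 𝒜 _ M P N _ _ _ _ _ _ _ _ _ _ _ _ gM _ _ gP _ _ gN _ _ φ ψ hA hφ hψ hinj
      hexact hsurj hK hsmall
    have := hA.isNoetherianRing
    simp only [regularity_eq_regularity_ofDecomposition]
    exact (corollary3p6_general hA.isGradedLocal ⟨isGradedHom_ofDecomposition 𝒜 hφ,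
      isGradedHom_ofDecomposition 𝒜 hψ, hinj, hexact, hsurj⟩).2 (hK.hasStrictResolution hA) hsmall
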